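/- Conventions. Inner products $\langle\cdot,\cdot\rangle$ are linear in the first argument. The CAR algebra $\mathfrak A(\mathcal H)$ over a complex Hilbert space $\mathcal H$ is the universal unital $C^*$-algebra generated by elements $a(h)$, $h\in\mathcal H$, such that $h\mapsto a^*(h):=a(h)^*$ is linear, $a(h)a(k)+a(k)a(h)=0$ and $a^*(h)a(k)+a(k)a^*(h)=\langle h,k\rangle 1$. A unitary $U$ on $\mathcal H$ gives the automorphism $\gamma_U$ with $\gamma_U(a(h))=a(Uh)$, and the GICAR algebra $\mathfrak I(\mathcal H)$ is the $C^*$-subalgebra of all $x\in\mathfrak A(\mathcal H)$ with $\gamma_{\lambda 1}(x)=x$ for all $\lambda\in\mathbb C$, $|\lambda|=1$; it is invariant under every $\gamma_U$. For a positive contraction $K$ on $\mathcal H$, $\varphi_K$ is the quasi-free state on $\mathfrak A(\mathcal H)$ with $$\varphi_K(a^*(h_n)\cdots a^*(h_1)a(k_1)\cdots a(k_m))=\delta_{n,m}\det[\langle Kh_i,k_j\rangle]_{i,j=1}^n\qquad(n,m\ge 0),$$ and $(\rho_K,\mathcal H_K,\Omega_K)$ is the GNS triple of $\varphi_K|_{\mathfrak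 I(\mathcal H)}$. The generator of a strongly continuous one-parameter unitary group $(V_t)_{t\in\mathbb R}$ is the operator $G$ with $G\xi=\lim_{t\to0}(V_t\xi-\xi)/(\mathrm i t)$, defined for all $\xi$ for which the limit exists, so that $V_t=e^{\mathrm i tG}$. Theorem. Let $\mathcal H$ be a separable complex Hilbert space, $A$ a (possibly unbounded) self-adjoint operator on $\mathcal H$, and $(v_\alpha)_{\alpha\in\mathcal I}$, with $\mathcal I$ countable, an orthonormal basis of $\mathcal H$ such that $v_\alpha\in\mathrm{dom}(A)$ and $Av_\alpha=m_\alpha v_\alpha$ with $m_\alpha\in\mathbb R$. Let $\mathcal I_0\subset\mathcal I$, and let $K$ be the orthogonal projection onto $\overline{\mathrm{span}}\{v_\alpha:\alpha\in\mathcal I_0\}$. There is exactly one strongly continuous one-parameter unitary group $(U_t)_{t\in\mathbb R}$ on $\mathcal H$ with generator $A$ (that is, $U_t=e^{\mathrm i tA}$), and exactly one strongly continuous one-parameter unitary group $(\Gamma_K(U_t))_{t\in\mathbb R}$ on $\mathcal H_K$ with $$\Gamma_K(U_t)\rho_K(x)\Omega_K=\rho_K(\gamma_{U_t}(x))\Omega_K\qquad(x\in\mathfrak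 I(\mathcal H),\ t\in\mathbb R).$$ Let $d\Gamma_K(A)$ be the generator of $(\Gamma_K(U_t))_{t\in\mathbb R}$, and let $\mathcal D\subset\mathcal H_K$ be the linear span of the vectors $$v_{\alpha_1,\dots,\alpha_n;\beta_1,\dots,\beta_n}:=\rho_K\bigl(a^*(v_{\alpha_1})\cdots a^*(v_{\alpha_n})a(v_{\beta_1})\cdots a(v_{\beta_n})\bigr)\Omega_K,\qquad n\ge 0,\ \alpha_i\in\mathcal I\setminus\mathcal I_0,\ \beta_i\in\mathcal I_0.$$ Then both series in $$\mathcal A\xi:=\sum_{\alpha\in\mathcal I\setminus\mathcal I_0}m_\alpha\,\rho_K(a^*(v_\alpha)a(v_\alpha))\xi-\sum_{\alpha\in\mathcal I_0}m_\alpha\,\rho_K(a(v_\alpha)a^*(v_\alpha))\xi$$ converge for every $\xi\in\mathcal D$, the operator $\mathcal A$ with domain $\mathcal D$ is closable, and its closure is $d\Gamma_K(A)$. -/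

import Mathlib

open scoped ComplexOrder InnerProductSpace ENNReal symmDiff

universe u

noncomputable section

/-! ### The CAR algebra -/

/-- The canonical anticommutation relations for an antilinear map `h ↦ a(h)` into a unital
C*-algebra. Mathlib's inner product `⟪k, h⟫_ℂ` is linear in `h` and antilinear in `k`. -/
structure IsCAR {H : Type*} [NormedAddCommGroup H] [InnerProductSpace ℂ H]
    {B : Type*} [CStarAlgebra B] (a : H →ₗ⋆[ℂ] B) : Prop where
  anticomm : ∀ h k, a h * a k + a k * a h = 0
  anticomm_star : ∀ h k, star (a h) * a k + a k * star (a h) = algebraMap ℂ B ⟪k, h⟫_ℂ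

theorem norm_le_of_anticomm {B : Type*} [CStarAlgebra B] {x : B} {c : ℝ} (hc : 0 ≤ c)
    (h1 : star x * x + x * star x = algebraMap ℂ B ((c ^ 2 : ℝ) : ℂ)) : ‖x‖ ≤ c := by
  let _ := CStarAlgebra.spectralOrder B
  let _ := CStarAlgebra.spectralOrderedRing B
  rcases subsingleton_or_nontrivial B with hB | hB
  · rw [Subsingleton.elim x 0, norm_zero]; exact hc
  have h2 : star x * x ≤ algebraMap ℂ B ((c ^ 2 : ℝ) : ℂ) := by
    rw [← h1]; exact le_add_of_nonneg_right (mul_star_self_nonneg _)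
  have h3 := CStarAlgebra.norm_le_norm_of_nonneg_of_le (star_mul_self_nonneg x) h2
  rw [CStarRing.norm_star_mul_self, norm_algebraMap', Complex.norm_real, norm_pow,
    Real.norm_of_nonneg hc] at h3
  nlinarith [norm_nonneg x]

theorem IsCAR.norm_le {H : Type*} [NormedAddCommGroup H] [InnerProductSpace ℂ H]
    {B : Type*} [CStarAlgebra B] {a : H →ₗ⋆[ℂ] B} (ha : IsCAR a) (h : H) : ‖a h‖ ≤ ‖h‖ := by
  refine norm_le_of_anticomm (norm_nonneg h) ?_
  rw [ha.anticomm_star, inner_self_eq_norm_sq_to_K]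
  simp

/-- A representation of the canonical anticommutation relations over `H` in a nonzero unital
C*-algebra. -/
structure CARRep (H : Type u) [NormedAddCommGroup H] [InnerProductSpace ℂ H] : Type (u + 1) where
  B : Type u
  [cstar : CStarAlgebra B]
  [nontrivial : Nontrivial B]
  a : H →ₗ⋆[ℂ] B
  isCAR : IsCAR a

attribute [instance] CARRep.cstar CARRep.nontrivial

section CAR
variable {H : Type u} [NormedAddCommGroup H] [InnerProductSpace ℂ H]

/-- The representation `h ↦ a(U h)`. -/
def CARRep.comp (π : CARRep H) (U : H ≃ₗᵢ[ℂ] H) : CARRep H where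
  B := π.B
  a := π.a.comp (U.toLinearEquiv : H →ₗ[ℂ] H)
  isCAR :=
    { anticomm := fun h k => π.isCAR.anticomm (U h) (U k)
      anticomm_star := fun h k => by
        simpa [U.inner_map_map] using π.isCAR.anticomm_star (U h) (U k) }

theorem CARRep.comp_comm (π : CARRep H) {U W : H ≃ₗᵢ[ℂ] H} (h : ∀ x, U (W x) = W (U x)) :
    (π.comp U).comp W = (π.comp W).comp U := by
  unfold CARRep.comp
  congr 1
  ext x
  exact congrArg π.a (h x)

variable (H) in
/-- The bounded families indexed by all representations, with the supremum norm. -/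
abbrev CARProd : Type (u + 1) := lp (fun π : CARRep H => π.B) ∞

instance : CStarAlgebra (CARProd H) where

/-- The family of the operators `a(h)` in all representations. -/
def CARProd.a (h : H) : CARProd H :=
  ⟨fun π => π.a h, memℓp_infty ⟨‖h‖, by rintro _ ⟨π, rfl⟩; exact π.isCAR.norm_le h⟩⟩

/-- Reindexing along `π ↦ π.comp U`. -/
def CARProd.bogoliubov (U : H ≃ₗᵢ[ℂ] H) : CARProd H →⋆ₐ[ℂ] CARProd H where
  toFun x := ⟨fun π => x (π.comp U), memℓp_infty ⟨‖x‖, by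
    rintro _ ⟨π, rfl⟩; exact lp.norm_apply_le_norm ENNReal.top_ne_zero x (π.comp U)⟩⟩
  map_one' := rfl
  map_mul' _ _ := rfl
  map_zero' := rfl
  map_add' _ _ := rfl
  commutes' _ := rfl
  map_star' _ := rfl

variable (H) in
/-- The C*-subalgebra of the product that is generated by the families `a(h)`. -/
def CARProd.carSubalgebra : StarSubalgebra ℂ (CARProd H) :=
  (StarAlgebra.adjoin ℂ (Set.range (CARProd.a (H := H)))).topologicalClosure

instance : IsClosed (CARProd.carSubalgebra H : Set (CARProd H)) :=
  StarSubalgebra.isClosed_topologicalClosure _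

theorem CARProd.bogoliubov_mem (U : H ≃ₗᵢ[ℂ] H) {x : CARProd H}
    (hx : x ∈ CARProd.carSubalgebra H) :
    CARProd.bogoliubov U x ∈ CARProd.carSubalgebra H := by
  have hc : Continuous (CARProd.bogoliubov U) :=
    AddMonoidHomClass.continuous_of_bound (CARProd.bogoliubov U) 1 fun y => by
      rw [one_mul]; exact NonUnitalStarAlgHom.norm_apply_le (CARProd.bogoliubov U) y
  have hle : StarAlgebra.adjoin ℂ (Set.range (CARProd.a (H := H))) ≤
      (StarAlgebra.adjoin ℂ (Set.range (CARProd.a (H := H)))).comap (CARProd.bogoliubov U) := by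
    refine StarAlgebra.adjoin_le ?_
    rintro _ ⟨h, rfl⟩
    exact StarAlgebra.subset_adjoin ℂ _ ⟨U h, rfl⟩
  exact map_mem_closure hc hx fun y hy => hle hy

variable (H) in
/-- The CAR algebra over `H`: the universal unital C*-algebra generated by elements `a(h)` subject
to the canonical anticommutation relations. It is realized inside the product of all
representations; the norm of a polynomial in the generators is the supremum of its norms in all
representations, and the homomorphism to a given representation `π` is the evaluation at `π`. -/
def CARAlgebra : Type (u + 1) := CARProd.carSubalgebra H

namespace CARAlgebra

instance : CStarAlgebra (CARAlgebra H) := inferInstanceAs (CStarAlgebra (CARProd.carSubalgebra H))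

instance : PartialOrder (CARAlgebra H) := CStarAlgebra.spectralOrder _

instance : StarOrderedRing (CARAlgebra H) := CStarAlgebra.spectralOrderedRing _

/-- The homomorphism to a given representation. -/
def eval (π : CARRep H) : CARAlgebra H →⋆ₐ[ℂ] π.B where
  toFun x := x.1 π
  map_one' := rfl
  map_mul' _ _ := rfl
  map_zero' := rfl
  map_add' _ _ := rfl
  commutes' _ := rfl
  map_star' _ := rfl

theorem ext_eval {x y : CARAlgebra H} (h : ∀ π, eval π x = eval π y) : x = y :=
  Subtype.ext (lp.ext (funext h))

/-- The annihilation operators `a(h)`; the creation operators are `a*(h) = star (a h)`. -/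
def a : H →ₗ⋆[ℂ] CARAlgebra H where
  toFun h := ⟨CARProd.a h, subset_closure (StarAlgebra.subset_adjoin ℂ _ ⟨h, rfl⟩)⟩
  map_add' h k := ext_eval fun π => π.a.map_add h k
  map_smul' c h := ext_eval fun π => π.a.map_smulₛₗ c h

theorem eval_a (π : CARRep H) (h : H) : eval π (a h) = π.a h := rfl

theorem isCAR_a : IsCAR (a (H := H)) where
  anticomm h k := ext_eval fun π => π.isCAR.anticomm h k
  anticomm_star h k := ext_eval fun π => π.isCAR.anticomm_star h k

theorem exists_lift {B : Type u} [CStarAlgebra B] [Nontrivial B] {f : H →ₗ⋆[ℂ] B} (hf : IsCAR f) :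
    ∃ ρ : CARAlgebra H →⋆ₐ[ℂ] B, ∀ h, ρ (a h) = f h :=
  ⟨eval { B := B, a := f, isCAR := hf }, fun _ => rfl⟩

/-- The Bogoliubov transform `γ_U`. -/
def bogoliubov (U : H ≃ₗᵢ[ℂ] H) : CARAlgebra H →⋆ₐ[ℂ] CARAlgebra H where
  toFun x := ⟨CARProd.bogoliubov U x.1, CARProd.bogoliubov_mem U x.2⟩
  map_one' := rfl
  map_mul' _ _ := rfl
  map_zero' := rfl
  map_add' _ _ := rfl
  commutes' _ := rfl
  map_star' _ := rfl

theorem bogoliubov_a (U : H ≃ₗᵢ[ℂ] H) (h : H) : bogoliubov U (a h) = a (U h) := rfl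

theorem apply_comp_comm (x : CARAlgebra H) (π : CARRep H) {U W : H ≃ₗᵢ[ℂ] H}
    (h : ∀ x, U (W x) = W (U x)) :
    (x.1 ((π.comp U).comp W) : π.B) = (x.1 ((π.comp W).comp U) : π.B) := by
  have key : ∀ σ τ : CARRep H, σ = τ → HEq (x.1 σ) (x.1 τ) := by rintro σ _ rfl; rfl
  exact eq_of_heq (key _ _ (π.comp_comm h))

theorem bogoliubov_comm {U W : H ≃ₗᵢ[ℂ] H} (h : ∀ x, U (W x) = W (U x)) (x : CARAlgebra H) :
    bogoliubov U (bogoliubov W x) = bogoliubov W (bogoliubov U x) :=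
  ext_eval fun π => x.apply_comp_comm π h

theorem continuous_bogoliubov (U : H ≃ₗᵢ[ℂ] H) : Continuous (bogoliubov U) :=
  AddMonoidHomClass.continuous_of_bound (bogoliubov U) 1 fun y => by
    rw [one_mul]; exact NonUnitalStarAlgHom.norm_apply_le (bogoliubov U) y

end CARAlgebra

/-! ### The gauge action and the GICAR algebra -/

variable (H) in
/-- Multiplication by a complex number of modulus one. -/
def gaugeUnitary (z : Circle) : H ≃ₗᵢ[ℂ] H where
  toLinearEquiv := LinearEquiv.smulOfNeZero ℂ H (z : ℂ) (Circle.coe_ne_zero z)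
  norm_map' x := by
    change ‖(z : ℂ) • x‖ = ‖x‖
    rw [norm_smul, Circle.norm_coe, one_mul]

theorem gaugeUnitary_apply (z : Circle) (x : H) : gaugeUnitary H z x = (z : ℂ) • x := rfl

open CARAlgebra in
variable (H) in
/-- The fixed points of the gauge action. -/
def gicarSubalgebra : StarSubalgebra ℂ (CARAlgebra H) where
  carrier := {x | ∀ z : Circle, bogoliubov (gaugeUnitary H z) x = x}
  mul_mem' hx hy z := by rw [map_mul, hx z, hy z]
  add_mem' hx hy z := by rw [map_add, hx z, hy z]
  algebraMap_mem' c z := AlgHomClass.commutes _ c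
  star_mem' hx z := by rw [map_star, hx z]

instance : IsClosed (gicarSubalgebra H : Set (CARAlgebra H)) := by
  change IsClosed {x : CARAlgebra H | ∀ z : Circle,
    CARAlgebra.bogoliubov (gaugeUnitary H z) x = x}
  simp only [Set.ofPred_forall]
  exact isClosed_iInter fun z => isClosed_eq (CARAlgebra.continuous_bogoliubov _) continuous_id

variable (H) in
/-- The GICAR algebra over `H`. -/
def GICAR : Type (u + 1) := gicarSubalgebra H

namespace GICAR

open CARAlgebra

instance : CStarAlgebra (GICAR H) := inferInstanceAs (CStarAlgebra (gicarSubalgebra H))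

instance : PartialOrder (GICAR H) := CStarAlgebra.spectralOrder _

instance : StarOrderedRing (GICAR H) := CStarAlgebra.spectralOrderedRing _

/-- The inclusion into the CAR algebra. -/
def incl : GICAR H →⋆ₐ[ℂ] CARAlgebra H := (gicarSubalgebra H).subtype

/-- The restriction of the Bogoliubov transform `γ_U` to the GICAR algebra. -/
def bogoliubov (U : H ≃ₗᵢ[ℂ] H) : GICAR H →⋆ₐ[ℂ] GICAR H where
  toFun x := ⟨CARAlgebra.bogoliubov U x.1, fun z => by
    rw [bogoliubov_comm (fun y => by simp [gaugeUnitary_apply]), x.2 z]⟩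
  map_one' := Subtype.ext (map_one (CARAlgebra.bogoliubov U))
  map_mul' x y := Subtype.ext (map_mul (CARAlgebra.bogoliubov U) x.1 y.1)
  map_zero' := Subtype.ext (map_zero (CARAlgebra.bogoliubov U))
  map_add' x y := Subtype.ext (map_add (CARAlgebra.bogoliubov U) x.1 y.1)
  commutes' c := Subtype.ext (AlgHomClass.commutes (CARAlgebra.bogoliubov U) c)
  map_star' x := Subtype.ext (map_star (CARAlgebra.bogoliubov U) x.1)

theorem gauge_a (z : Circle) (h : H) :
    CARAlgebra.bogoliubov (gaugeUnitary H z) (a h) = star (z : ℂ) • a h := by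
  rw [bogoliubov_a, gaugeUnitary_apply, map_smulₛₗ]; rfl

theorem gauge_star_a (z : Circle) (h : H) :
    CARAlgebra.bogoliubov (gaugeUnitary H z) (star (a h)) = (z : ℂ) • star (a h) := by
  rw [map_star, gauge_a, star_smul, star_star]

theorem circle_mul_star (z : Circle) : (z : ℂ) * star (z : ℂ) = 1 := by
  change (z : ℂ) * (starRingEnd ℂ) (z : ℂ) = 1
  rw [Complex.mul_conj', Circle.norm_coe]; simp

theorem gauge_prod_a (z : Circle) {n : ℕ} (k : Fin n → H) :
    CARAlgebra.bogoliubov (gaugeUnitary H z) (List.ofFn fun i => a (k i)).prod =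
      star (z : ℂ) ^ n • (List.ofFn fun i => a (k i)).prod := by
  induction n with
  | zero => simp
  | succ n ih =>
    simp only [List.ofFn_succ, List.prod_cons, map_mul, gauge_a, ih fun i => k i.succ,
      smul_mul_smul_comm, pow_succ']

theorem gauge_prod_star_a (z : Circle) {n : ℕ} (h : Fin n → H) :
    CARAlgebra.bogoliubov (gaugeUnitary H z) (List.ofFn fun i => star (a (h i))).prod =
      (z : ℂ) ^ n • (List.ofFn fun i => star (a (h i))).prod := by
  induction n with
  | zero => simp
  | succ n ih =>
    simp only [List.ofFn_succ, List.prod_cons, map_mul, gauge_star_a, ih fun i => h i.succ,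
      smul_mul_smul_comm, pow_succ']

/-- The element `a*(h₁) ⋯ a*(hₙ) a(k₁) ⋯ a(kₙ)`. -/
def monomial {n : ℕ} (h k : Fin n → H) : GICAR H :=
  ⟨(List.ofFn fun i => star (a (h i))).prod * (List.ofFn fun i => a (k i)).prod, fun z => by
    rw [map_mul, gauge_prod_star_a, gauge_prod_a, smul_mul_smul_comm, ← mul_pow, circle_mul_star,
      one_pow, one_smul]⟩

/-- The element `a*(h) a(k)`. -/
def creAnn (h k : H) : GICAR H :=
  ⟨star (a h) * a k, fun z => by
    rw [map_mul, gauge_star_a, gauge_a, smul_mul_smul_comm, circle_mul_star, one_smul]⟩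

/-- The element `a(h) a*(k)`. -/
def annCre (h k : H) : GICAR H :=
  ⟨a h * star (a k), fun z => by
    rw [map_mul, gauge_star_a, gauge_a, smul_mul_smul_comm, mul_comm (star _), circle_mul_star,
      one_smul]⟩

end GICAR

end CAR

/-! ### The Fock representation -/

namespace Fock
variable {J : Type u} [LinearOrder J]

/-- The antisymmetric Fock space in the occupation number picture: the basis vectors are
labelled by the finite sets of occupied modes. -/
abbrev Space (J : Type u) : Type u := lp (fun _ : Finset J => ℂ) 2

/-- Change of the occupation of the mode `j`. -/
def flip (j : J) : Finset J ≃ Finset J where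
  toFun S := S ∆ {j}
  invFun S := S ∆ {j}
  left_inv S := by simp
  right_inv S := by simp

theorem flip_flip (j : J) (S : Finset J) : flip j (flip j S) = S := (flip j).left_inv S

theorem flip_comm (j k : J) (S : Finset J) : flip j (flip k S) = flip k (flip j S) := by
  simp [flip, symmDiff_right_comm]

theorem mem_flip_self (j : J) (S : Finset J) : j ∈ flip j S ↔ j ∉ S := by
  simp [flip, Finset.mem_symmDiff]

theorem mem_flip_of_ne {j k : J} (h : j ≠ k) (S : Finset J) : j ∈ flip k S ↔ j ∈ S := by
  simp [flip, Finset.mem_symmDiff, h]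

theorem memlp_flip (g : Finset J → ℂ) (hg : ∀ S, ‖g S‖ ≤ 1) (j : J) (f : Space J) :
    Memℓp (fun S => g S * f (flip j S)) 2 := by
  have h2 : (0 : ℝ) < (2 : ℝ≥0∞).toReal := by simp
  have hf : Summable fun S => ‖f S‖ ^ (2 : ℝ≥0∞).toReal := (memℓp_gen_iff h2).1 (lp.memℓp f)
  refine (memℓp_gen_iff h2).2 (Summable.of_nonneg_of_le (fun _ => by positivity) (fun S => ?_)
    ((flip j).summable_iff.2 hf))
  simp only [Function.comp, norm_mul]
  gcongr
  exact mul_le_of_le_one_left (norm_nonneg _) (hg S)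

/-- The operator `(T f)(S) = g(S) f(S ∆ {j})`. -/
def weighted (g : Finset J → ℂ) (hg : ∀ S, ‖g S‖ ≤ 1) (j : J) : Space J →L[ℂ] Space J :=
  LinearMap.mkContinuous
    { toFun := fun f => ⟨fun S => g S * f (flip j S), memlp_flip g hg j f⟩
      map_add' := fun f f' => by ext S; exact mul_add _ _ _
      map_smul' := fun c f => by ext S; simp [mul_left_comm] } 1 (fun f => by
    have h2 : (0 : ℝ) < (2 : ℝ≥0∞).toReal := by simp
    have hf : Summable fun S => ‖f S‖ ^ (2 : ℝ≥0∞).toReal := (memℓp_gen_iff h2).1 (lp.memℓp f)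
    rw [one_mul]
    refine lp.norm_le_of_tsum_le h2 (norm_nonneg _) ?_
    rw [lp.norm_rpow_eq_tsum h2, ← (flip j).tsum_eq fun S => ‖f S‖ ^ (2 : ℝ≥0∞).toReal]
    refine Summable.tsum_le_tsum (fun S => ?_) ((memℓp_gen_iff h2).1 (memlp_flip g hg j f))
      ((flip j).summable_iff.2 hf)
    simp only [LinearMap.coe_mk, AddHom.coe_mk, norm_mul]
    gcongr
    exact mul_le_of_le_one_left (norm_nonneg _) (hg S))

theorem weighted_apply (g : Finset J → ℂ) (hg : ∀ S, ‖g S‖ ≤ 1) (j : J) (f : Space J)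
    (S : Finset J) : weighted g hg j f S = g S * f (flip j S) := rfl

/-- The sign `(-1)^#{i ∈ S : i < j}`. -/
def sgn (j : J) (S : Finset J) : ℂ := ∏ i ∈ S, if i < j then -1 else 1

theorem sgn_cases (j : J) (S : Finset J) : sgn j S = 1 ∨ sgn j S = -1 := by
  unfold sgn
  induction S using Finset.induction_on with
  | empty => simp
  | insert i S hi ih => rw [Finset.prod_insert hi]; rcases ih with h | h <;> rw [h] <;> split_ifs <;> simp

theorem sgn_mul_self (j : J) (S : Finset J) : sgn j S * sgn j S = 1 := by
  rcases sgn_cases j S with h | h <;> simp [h]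

theorem norm_sgn (j : J) (S : Finset J) : ‖sgn j S‖ = 1 := by
  rcases sgn_cases j S with h | h <;> simp [h]

theorem star_sgn (j : J) (S : Finset J) : (starRingEnd ℂ) (sgn j S) = sgn j S := by
  rcases sgn_cases j S with h | h <;> simp [h]

theorem sgn_flip (k j : J) (S : Finset J) :
    sgn k (flip j S) = (if j < k then -1 else 1) * sgn k S := by
  by_cases hj : j ∈ S
  · have : flip j S = S.erase j := by
      ext i; by_cases h : i = j <;> simp [flip, Finset.mem_symmDiff, h, hj]
    rw [this, sgn, sgn, ← Finset.mul_prod_erase S _ hj, ← mul_assoc]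
    split_ifs <;> simp
  · have : flip j S = insert j S := by
      ext i; by_cases h : i = j <;> simp [flip, Finset.mem_symmDiff, h, hj]
    rw [this, sgn, sgn, Finset.prod_insert hj]

def wAnn (j : J) (S : Finset J) : ℂ := if j ∈ S then 0 else sgn j S
def wCre (j : J) (S : Finset J) : ℂ := if j ∈ S then sgn j S else 0

theorem norm_wAnn (j : J) (S : Finset J) : ‖wAnn j S‖ ≤ 1 := by
  unfold wAnn; split_ifs <;> simp [norm_sgn]
theorem norm_wCre (j : J) (S : Finset J) : ‖wCre j S‖ ≤ 1 := by
  unfold wCre; split_ifs <;> simp [norm_sgn]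

/-- The annihilation operator of the mode `j`. -/
def ann (j : J) : Space J →L[ℂ] Space J := weighted (wAnn j) (norm_wAnn j) j
/-- The creation operator of the mode `j`. -/
def cre (j : J) : Space J →L[ℂ] Space J := weighted (wCre j) (norm_wCre j) j

theorem star_ann (j : J) : star (ann j) = cre j := by
  symm
  rw [ContinuousLinearMap.star_eq_adjoint, ContinuousLinearMap.eq_adjoint_iff]
  intro x y
  rw [lp.inner_eq_tsum, lp.inner_eq_tsum, ← (flip j).tsum_eq]
  refine tsum_congr fun S => ?_
  have h : wCre j (flip j S) = wAnn j S := by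
    simp only [wCre, wAnn, mem_flip_self, sgn_flip, lt_irrefl, if_false, one_mul]
    split_ifs <;> simp_all
  have h' : (starRingEnd ℂ) (wAnn j S) = wAnn j S := by
    unfold wAnn; split_ifs <;> simp [star_sgn]
  simp only [cre, ann, weighted_apply, RCLike.inner_apply, map_mul, h, h', flip_flip]
  ring

theorem ann_ann (j k : J) : ann j * ann k + ann k * ann j = 0 := by
  ext f S
  change wAnn j S * (wAnn k (flip j S) * f (flip k (flip j S))) +
    wAnn k S * (wAnn j (flip k S) * f (flip j (flip k S))) = 0
  rw [flip_comm j k]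
  rcases eq_or_ne j k with rfl | hjk
  · simp only [wAnn, mem_flip_self]; split_ifs <;> simp_all
  · simp only [wAnn, mem_flip_of_ne hjk, mem_flip_of_ne hjk.symm, sgn_flip]
    rcases lt_or_gt_of_ne hjk with h | h <;> simp only [h, not_lt_of_gt h, if_true, if_false] <;>
      split_ifs <;> ring

theorem cre_ann (j k : J) : cre j * ann k + ann k * cre j = if j = k then 1 else 0 := by
  ext f S
  have h0 : (cre j * ann k + ann k * cre j) f S =
    wCre j S * (wAnn k (flip j S) * f (flip k (flip j S))) +
    wAnn k S * (wCre j (flip k S) * f (flip j (flip k S))) := rfl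
  rw [h0, flip_comm j k]
  rcases eq_or_ne j k with rfl | hjk
  · have := sgn_mul_self j S
    simp only [wAnn, wCre, mem_flip_self, flip_flip, sgn_flip, lt_irrefl, if_false, one_mul, if_true]
    by_cases hS : j ∈ S
    · simp [hS, ← mul_assoc, this]
    · simp [hS, ← mul_assoc, this]
  · simp only [wAnn, wCre, mem_flip_of_ne hjk, mem_flip_of_ne hjk.symm, sgn_flip, if_neg hjk]
    rcases lt_or_gt_of_ne hjk with h | h <;> simp only [h, not_lt_of_gt h, if_true, if_false] <;>
      split_ifs <;> simp <;> ring

/-- The vacuum vector. -/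
def vac : Space J := lp.single 2 ∅ 1

theorem ann_vac (j : J) : ann j (vac : Space J) = 0 := by
  ext S
  rw [ann, weighted_apply]
  by_cases h : j ∈ S
  · simp [wAnn, h]
  · have : flip j S ≠ ∅ := fun h' => by
      have := (mem_flip_self j S).2 h
      rw [h'] at this; simp at this
    simp [vac, lp.single_apply, this]

variable {E : Type*} [NormedAddCommGroup E] [InnerProductSpace ℂ E] (b : HilbertBasis J ℂ E)

def term (h : E) (j : J) : Space J →L[ℂ] Space J := ⟪h, b j⟫_ℂ • ann j

theorem anticomm_sum (h k : E) (T : Finset J) :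
    (∑ j ∈ T, term b h j) * (∑ j ∈ T, term b k j) +
      (∑ j ∈ T, term b k j) * (∑ j ∈ T, term b h j) = 0 := by
  rw [Finset.sum_mul_sum, Finset.sum_mul_sum, Finset.sum_comm, ← Finset.sum_add_distrib]
  refine Finset.sum_eq_zero fun i _ => ?_
  rw [← Finset.sum_add_distrib]
  refine Finset.sum_eq_zero fun j _ => ?_
  simp only [term, smul_mul_smul_comm]
  rw [mul_comm ⟪k, b i⟫_ℂ, ← smul_add, ann_ann, smul_zero]

theorem anticomm_star_sum (h k : E) (T : Finset J) :
    star (∑ j ∈ T, term b h j) * (∑ j ∈ T, term b k j) +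
      (∑ j ∈ T, term b k j) * star (∑ j ∈ T, term b h j) =
      algebraMap ℂ _ (∑ j ∈ T, ⟪k, b j⟫_ℂ * ⟪b j, h⟫_ℂ) := by
  rw [star_sum, Finset.sum_mul_sum, Finset.sum_mul_sum, Finset.sum_comm (s := T) (t := T)
    (f := fun i j => term b k i * star (term b h j)), ← Finset.sum_add_distrib, map_sum]
  refine Finset.sum_congr rfl fun i hi => ?_
  rw [← Finset.sum_add_distrib, Finset.sum_eq_single i]
  · simp only [term, star_smul, smul_mul_smul_comm, star_ann]
    rw [mul_comm (star _), ← smul_add, cre_ann, if_pos rfl, Algebra.algebraMap_eq_smul_one]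
    simp
  · intro j _ hj
    simp only [term, star_smul, smul_mul_smul_comm, star_ann]
    rw [mul_comm (star _), ← smul_add, cre_ann, if_neg hj.symm, smul_zero]
  · exact fun h => absurd hi h

theorem summable_term (h : E) : Summable (term b h) := by
  rw [summable_iff_vanishing_norm]
  intro ε hε
  have hs : Summable fun j => ‖⟪h, b j⟫_ℂ‖ ^ 2 := by
    have := (b.summable_inner_mul_inner h h).norm
    refine this.congr fun j => ?_
    rw [norm_mul, norm_inner_symm (b j) h, sq]
  obtain ⟨s, hs⟩ := (summable_iff_vanishing_norm.1 hs) (ε ^ 2) (by positivity)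
  refine ⟨s, fun t ht => ?_⟩
  have h1 := hs t ht
  rw [Real.norm_of_nonneg (Finset.sum_nonneg fun _ _ => by positivity)] at h1
  have h2 : ‖∑ j ∈ t, term b h j‖ ≤ √(∑ j ∈ t, ‖⟪h, b j⟫_ℂ‖ ^ 2) := by
    refine norm_le_of_anticomm (Real.sqrt_nonneg _) ?_
    rw [anticomm_star_sum, Real.sq_sqrt (Finset.sum_nonneg fun _ _ => by positivity)]
    push_cast
    congr 1
    refine Finset.sum_congr rfl fun j _ => ?_
    rw [← inner_conj_symm (b j) h, Complex.mul_conj']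
  refine h2.trans_lt ?_
  rw [Real.sqrt_lt' hε]
  exact h1

/-- The annihilation operators `a(h) = ∑ⱼ ⟪h, bⱼ⟫ aⱼ`. -/
def a : E →ₗ⋆[ℂ] (Space J →L[ℂ] Space J) where
  toFun h := ∑' j, term b h j
  map_add' h k := by
    rw [← (summable_term b h).tsum_add (summable_term b k)]
    refine tsum_congr fun j => ?_
    simp [term, add_smul]
  map_smul' c h := by
    rw [← tsum_const_smul'']
    refine tsum_congr fun j => ?_
    simp [term, smul_smul, mul_comm]

theorem hasSum_a (h : E) : HasSum (term b h) (a b h) := (summable_term b h).hasSum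

theorem isCAR_a : IsCAR (a b) where
  anticomm h k := by
    have h1 := (Filter.Tendsto.mul (hasSum_a b h) (hasSum_a b k)).add
      (Filter.Tendsto.mul (hasSum_a b k) (hasSum_a b h))
    refine tendsto_nhds_unique h1 ?_
    simp only [anticomm_sum]
    exact tendsto_const_nhds
  anticomm_star h k := by
    have h0 : Filter.Tendsto (fun T : Finset J => star (∑ j ∈ T, term b h j)) Filter.atTop
      (nhds (star (a b h))) := (continuous_star.tendsto _).comp (hasSum_a b h)
    have h1 := (h0.mul (hasSum_a b k)).add (Filter.Tendsto.mul (hasSum_a b k) h0)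
    refine tendsto_nhds_unique h1 ?_
    simp only [anticomm_star_sum]
    exact ((algebraMapCLM ℂ _).continuous.tendsto _).comp (b.hasSum_inner_mul_inner k h)

theorem a_vac (h : E) : a b h (vac : Space J) = 0 := by
  have h1 := (ContinuousLinearMap.apply ℂ (Space J) (vac : Space J)).hasSum (hasSum_a b h)
  refine h1.unique ?_
  have : (fun j => (ContinuousLinearMap.apply ℂ (Space J) (vac : Space J)) (term b h j)) = 0 := by
    funext j; simp [term, ann_vac]
  rw [this]
  exact hasSum_zero

section Gram
variable {E : Type*} [NormedAddCommGroup E] [InnerProductSpace ℂ E]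
  {F : Type*} [NormedAddCommGroup F] [InnerProductSpace ℂ F] [CompleteSpace F]

/-- The vector `a*(f₁) ⋯ a*(fₙ) Ω`. -/
def wedge (a : E →ₗ⋆[ℂ] (F →L[ℂ] F)) (Ω : F) {n : ℕ} (f : Fin n → E) : F := (List.ofFn fun i => star (a (f i))).prod Ω

theorem wedge_zero {a : E →ₗ⋆[ℂ] (F →L[ℂ] F)} (Ω : F) (f : Fin 0 → E) : wedge a Ω f = Ω := by simp [wedge]

theorem wedge_succ {a : E →ₗ⋆[ℂ] (F →L[ℂ] F)} (Ω : F) {n : ℕ} (f : Fin (n + 1) → E) :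
    wedge a Ω f = star (a (f 0)) (wedge a Ω fun i => f i.succ) := by
  simp [wedge, List.ofFn_succ]

theorem ann_cre_apply {a : E →ₗ⋆[ℂ] (F →L[ℂ] F)} (ha : IsCAR a) (h g : E) (x : F) :
    a h (star (a g) x) = ⟪h, g⟫_ℂ • x - star (a g) (a h x) := by
  have := congrArg (fun T : F →L[ℂ] F => T x) (ha.anticomm_star g h)
  rw [Algebra.algebraMap_eq_smul_one] at this
  change star (a g) (a h x) + a h (star (a g) x) = ⟪h, g⟫_ℂ • x at this
  rw [← this]; abel

theorem ann_wedge {a : E →ₗ⋆[ℂ] (F →L[ℂ] F)} (ha : IsCAR a) (Ω : F)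
    (hΩ : ∀ h, a h Ω = 0) {n : ℕ} (h : E) (g : Fin (n + 1) → E) :
    a h (wedge a Ω g) =
      ∑ j : Fin (n + 1), ((-1) ^ (j : ℕ) * ⟪h, g j⟫_ℂ) • wedge a Ω fun i => g (j.succAbove i) := by
  induction n with
  | zero => rw [wedge_succ, ann_cre_apply ha, wedge_zero, hΩ]; simp [wedge_zero]
  | succ n ih =>
    rw [wedge_succ, ann_cre_apply ha, ih, map_sum, Fin.sum_univ_succ (n := n + 1), sub_eq_add_neg,
      ← Finset.sum_neg_distrib]
    congr 1
    · simp
    · refine Finset.sum_congr rfl fun j _ => ?_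
      rw [wedge_succ (n := n) (f := fun i => g (j.succ.succAbove i))]
      simp [pow_succ]

theorem inner_wedge {a : E →ₗ⋆[ℂ] (F →L[ℂ] F)} (ha : IsCAR a) (Ω : F)
    (hΩ : ∀ h, a h Ω = 0) {n : ℕ} (hΩ1 : ‖Ω‖ = 1) (f g : Fin n → E) :
    ⟪wedge a Ω f, wedge a Ω g⟫_ℂ = (Matrix.of fun i j => ⟪f i, g j⟫_ℂ).det := by
  induction n with
  | zero => simp [wedge_zero, hΩ1, inner_self_eq_norm_sq_to_K]
  | succ n ih =>
    rw [wedge_succ Ω f, ContinuousLinearMap.star_eq_adjoint,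
      ContinuousLinearMap.adjoint_inner_left, ann_wedge ha Ω hΩ, inner_sum,
      Matrix.det_succ_row_zero]
    refine Finset.sum_congr rfl fun j _ => ?_
    rw [inner_smul_right, ih]
    rfl

theorem inner_wedge_of_ne {a : E →ₗ⋆[ℂ] (F →L[ℂ] F)} (ha : IsCAR a) (Ω : F)
    (hΩ : ∀ h, a h Ω = 0) {n m : ℕ} (hnm : n ≠ m) (f : Fin n → E) (g : Fin m → E) :
    ⟪wedge a Ω f, wedge a Ω g⟫_ℂ = 0 := by
  induction n generalizing m with
  | zero =>
    obtain ⟨m, rfl⟩ := Nat.exists_eq_succ_of_ne_zero hnm.symm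
    rw [wedge_zero, wedge_succ, ContinuousLinearMap.star_eq_adjoint,
      ContinuousLinearMap.adjoint_inner_right, hΩ, inner_zero_left]
  | succ n ih =>
    rw [wedge_succ Ω f, ContinuousLinearMap.star_eq_adjoint,
      ContinuousLinearMap.adjoint_inner_left]
    cases m with
    | zero => rw [wedge_zero, hΩ, inner_zero_right]
    | succ m =>
      rw [ann_wedge ha Ω hΩ, inner_sum]
      refine Finset.sum_eq_zero fun j _ => ?_
      rw [inner_smul_right, ih (by omega), mul_zero]
end Gram

section Quasi
variable {H : Type*} [NormedAddCommGroup H] [InnerProductSpace ℂ H]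
  {F : Type*} [NormedAddCommGroup F] [InnerProductSpace ℂ F] [CompleteSpace F]

/-- `h ↦ a(S h ⊕ 0) + a*(0 ⊕ C T h)`, with `C` a conjugation. -/
def doubled (a : WithLp 2 (H × H) →ₗ⋆[ℂ] (F →L[ℂ] F)) (S T : H →L[ℂ] H) (C : H →ₗ⋆[ℂ] H) : H →ₗ⋆[ℂ] (F →L[ℂ] F) where
  toFun h := a (WithLp.toLp 2 (S h, 0)) + star (a (WithLp.toLp 2 (0, C (T h))))
  map_add' h k := by
    have h1 : WithLp.toLp 2 (S (h + k), (0 : H)) =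
      WithLp.toLp 2 (S h, 0) + WithLp.toLp 2 (S k, 0) := by
      rw [← WithLp.toLp_add]; simp
    have h2 : WithLp.toLp 2 ((0 : H), C (T (h + k))) =
      WithLp.toLp 2 (0, C (T h)) + WithLp.toLp 2 (0, C (T k)) := by
      rw [← WithLp.toLp_add]; simp
    rw [h1, h2, map_add, map_add, star_add]; abel
  map_smul' c h := by
    have h1 : WithLp.toLp 2 (S (c • h), (0 : H)) = c • WithLp.toLp 2 (S h, 0) := by
      rw [← WithLp.toLp_smul]; simp
    have h2 : WithLp.toLp 2 ((0 : H), C (T (c • h))) =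
      (starRingEnd ℂ) c • WithLp.toLp 2 (0, C (T h)) := by
      rw [← WithLp.toLp_smul]; simp
    rw [h1, h2, map_smulₛₗ, map_smulₛₗ, star_smul, smul_add]; simp

theorem isCAR_doubled {a : WithLp 2 (H × H) →ₗ⋆[ℂ] (F →L[ℂ] F)} (ha : IsCAR a) {S T : H →L[ℂ] H} {C : H →ₗ⋆[ℂ] H}
    (hC : ∀ x y, ⟪C x, C y⟫_ℂ = ⟪y, x⟫_ℂ)
    (hST : ∀ x y, ⟪S x, S y⟫_ℂ + ⟪T x, T y⟫_ℂ = ⟪x, y⟫_ℂ) : IsCAR (doubled a S T C) where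
  anticomm h k := by
    have h1 := ha.anticomm (WithLp.toLp 2 (S h, 0)) (WithLp.toLp 2 (S k, 0))
    have h2 := congrArg star
      (ha.anticomm (WithLp.toLp 2 (0, C (T k))) (WithLp.toLp 2 (0, C (T h))))
    have h3 := ha.anticomm_star (WithLp.toLp 2 (0, C (T k))) (WithLp.toLp 2 (S h, 0))
    have h4 := ha.anticomm_star (WithLp.toLp 2 (0, C (T h))) (WithLp.toLp 2 (S k, 0))
    simp only [WithLp.prod_inner_apply, inner_zero_left, inner_zero_right, add_zero, map_zero] at h3 h4
    simp only [star_add, star_mul, star_zero] at h2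
    simp only [doubled, LinearMap.coe_mk, AddHom.coe_mk, add_mul, mul_add]
    linear_combination (norm := abel) h1 + h2 + h3 + h4
  anticomm_star h k := by
    have h1 := ha.anticomm_star (WithLp.toLp 2 (S h, 0)) (WithLp.toLp 2 (S k, 0))
    have h2 := ha.anticomm_star (WithLp.toLp 2 (0, C (T k))) (WithLp.toLp 2 (0, C (T h)))
    have h3 := congrArg star (ha.anticomm (WithLp.toLp 2 (S h, 0)) (WithLp.toLp 2 (0, C (T k))))
    have h4 := ha.anticomm (WithLp.toLp 2 (0, C (T h))) (WithLp.toLp 2 (S k, 0))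
    have h5 := congrArg (algebraMap ℂ (F →L[ℂ] F)) (hST k h)
    simp only [WithLp.prod_inner_apply, inner_zero_right, add_zero, zero_add, hC] at h1 h2
    rw [map_add] at h5
    simp only [star_add, star_mul, star_zero] at h3
    simp only [doubled, LinearMap.coe_mk, AddHom.coe_mk, add_mul, mul_add, star_add, star_star]
    linear_combination (norm := abel) h1 + h2 + h3 + h4 + h5

theorem doubled_prod_vac {a : WithLp 2 (H × H) →ₗ⋆[ℂ] (F →L[ℂ] F)} (ha : IsCAR a) {S T : H →L[ℂ] H} {C : H →ₗ⋆[ℂ] H} (Ω : F)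
    (hΩ : ∀ h, a h Ω = 0) {n : ℕ} (k : Fin n → H) :
    (List.ofFn fun i => doubled a S T C (k i)).prod Ω =
      wedge a Ω fun i => WithLp.toLp 2 (0, C (T (k i))) := by
  induction n with
  | zero => simp [wedge_zero]
  | succ n ih =>
    rw [List.ofFn_succ, List.prod_cons, wedge_succ]
    change doubled a S T C (k 0) ((List.ofFn fun i => doubled a S T C (k i.succ)).prod Ω) = _
    rw [ih fun i => k i.succ]
    have h0 : a (WithLp.toLp 2 (S (k 0), 0))
        (wedge a Ω fun i : Fin n => WithLp.toLp 2 (0, C (T (k i.succ)))) = 0 := by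
      cases n with
      | zero => rw [wedge_zero, hΩ]
      | succ n =>
        rw [ann_wedge ha Ω hΩ]
        refine Finset.sum_eq_zero fun j _ => ?_
        simp [WithLp.prod_inner_apply]
    simp only [doubled, LinearMap.coe_mk, AddHom.coe_mk, add_apply, h0, zero_add]

theorem exists_conj (H : Type*) [NormedAddCommGroup H] [InnerProductSpace ℂ H] [CompleteSpace H] :
    ∃ C : H →ₗ⋆[ℂ] H, ∀ x y, ⟪C x, C y⟫_ℂ = ⟪y, x⟫_ℂ := by
  obtain ⟨w, b, -⟩ := exists_hilbertBasis ℂ H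
  refine ⟨⟨⟨fun x => b.repr.symm (star (b.repr x)), fun x y => by simp⟩, fun c x => by simp⟩, ?_⟩
  intro x y
  change ⟪b.repr.symm (star (b.repr x)), b.repr.symm (star (b.repr y))⟫_ℂ = _
  rw [b.repr.symm.inner_map_map, ← b.repr.inner_map_map y x, lp.inner_eq_tsum, lp.inner_eq_tsum]
  refine tsum_congr fun i => ?_
  simp [mul_comm]
end Quasi

end Fock

/-! ### Quasi-free states -/

section QuasiFree
variable {H : Type u} [NormedAddCommGroup H] [InnerProductSpace ℂ H]

open CARAlgebra in
/-- `φ` is a quasi-free state on the CAR algebra with `φ(a*(h) a(k)) = ⟨K h, k⟩`. Note that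
`a*(hₙ) ⋯ a*(h₁)` is the adjoint of `a(h₁) ⋯ a(hₙ)`. -/
structure IsQuasiFreeState (K : H →L[ℂ] H) (φ : CARAlgebra H →ₚ[ℂ] ℂ) : Prop where
  map_one : φ 1 = 1
  map_monomial : ∀ (n : ℕ) (h k : Fin n → H),
    φ (star (List.ofFn fun i => a (h i)).prod * (List.ofFn fun i => a (k i)).prod) =
      (Matrix.of fun i j => φ (star (a (h i)) * a (k j))).det
  map_monomial_of_ne : ∀ (n m : ℕ) (h : Fin n → H) (k : Fin m → H), n ≠ m →
    φ (star (List.ofFn fun i => a (h i)).prod * (List.ofFn fun i => a (k i)).prod) = 0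
  two_point : ∀ h k : H, φ (star (a h) * a k) = ⟪k, K h⟫_ℂ

theorem inner_star_mul {F : Type*} [NormedAddCommGroup F] [InnerProductSpace ℂ F]
    [CompleteSpace F] (ρ : CARAlgebra H →⋆ₐ[ℂ] (F →L[ℂ] F)) (Ω : F) (x y : CARAlgebra H) :
    ⟪Ω, ρ (star x * y) Ω⟫_ℂ = ⟪ρ x Ω, ρ y Ω⟫_ℂ := by
  have h : ρ (star x * y) = ContinuousLinearMap.adjoint (ρ x) * ρ y := by
    rw [map_mul, map_star, ContinuousLinearMap.star_eq_adjoint]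
  rw [h]
  exact ContinuousLinearMap.adjoint_inner_right (ρ x) Ω (ρ y Ω)

/-- The functional `x ↦ ⟨ρ(x) Ω, Ω⟩`. -/
def vectorFunctional {F : Type*} [NormedAddCommGroup F] [InnerProductSpace ℂ F] [CompleteSpace F]
    (ρ : CARAlgebra H →⋆ₐ[ℂ] (F →L[ℂ] F)) (Ω : F) : CARAlgebra H →ₚ[ℂ] ℂ :=
  PositiveLinearMap.mk₀
    { toFun := fun x => ⟪Ω, ρ x Ω⟫_ℂ
      map_add' := fun x y => by rw [map_add, ← inner_add_right]; rfl
      map_smul' := fun c x => by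
        rw [map_smul, RingHom.id_apply, smul_eq_mul, ← inner_smul_right]; rfl } (fun x hx => by
    obtain ⟨y, rfl⟩ := CStarAlgebra.nonneg_iff_eq_star_mul_self.1 hx
    change 0 ≤ ⟪Ω, ρ (star y * y) Ω⟫_ℂ
    rw [inner_star_mul, inner_self_eq_norm_sq_to_K, ← RCLike.ofReal_pow]
    exact RCLike.ofReal_nonneg.2 (sq_nonneg ‖ρ y Ω‖))

theorem vectorFunctional_star_mul {F : Type*} [NormedAddCommGroup F] [InnerProductSpace ℂ F]
    [CompleteSpace F] (ρ : CARAlgebra H →⋆ₐ[ℂ] (F →L[ℂ] F)) (Ω : F) (x y : CARAlgebra H) :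
    vectorFunctional ρ Ω (star x * y) = ⟪ρ x Ω, ρ y Ω⟫_ℂ :=
  inner_star_mul ρ Ω x y

open CARAlgebra in
theorem exists_isQuasiFreeState [CompleteSpace H] (K : H →L[ℂ] H) (hK₀ : 0 ≤ K) (hK₁ : K ≤ 1) :
    ∃ φ : CARAlgebra H →ₚ[ℂ] ℂ, IsQuasiFreeState K φ := by
  obtain ⟨w, b, -⟩ := exists_hilbertBasis ℂ (WithLp 2 (H × H))
  obtain ⟨C, hC⟩ := Fock.exists_conj H
  classical
  let _ : LinearOrder w := linearOrderOfSTO WellOrderingRel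
  let S : H →L[ℂ] H := CFC.sqrt (1 - K)
  let T : H →L[ℂ] H := CFC.sqrt K
  have hS : ∀ x y, ⟪S x, S y⟫_ℂ = ⟪x, (1 - K) y⟫_ℂ := fun x y => by
    have h1 : IsSelfAdjoint S := .of_nonneg (CFC.sqrt_nonneg _)
    have h2 : S * S = 1 - K := CFC.sqrt_mul_sqrt_self _ (sub_nonneg.2 hK₁)
    rw [← h2, ← ContinuousLinearMap.adjoint_inner_right, h1.adjoint_eq]
    rfl
  have hT : ∀ x y, ⟪T x, T y⟫_ℂ = ⟪x, K y⟫_ℂ := fun x y => by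
    have h1 : IsSelfAdjoint T := .of_nonneg (CFC.sqrt_nonneg _)
    have h2 : T * T = K := CFC.sqrt_mul_sqrt_self _ hK₀
    rw [← ContinuousLinearMap.adjoint_inner_right, h1.adjoint_eq]
    exact congrArg (fun R : H →L[ℂ] H => ⟪x, R y⟫_ℂ) h2
  have hST : ∀ x y, ⟪S x, S y⟫_ℂ + ⟪T x, T y⟫_ℂ = ⟪x, y⟫_ℂ := fun x y => by
    rw [hS, hT, ← inner_add_right]; simp
  let Ω : Fock.Space w := Fock.vac
  have hΩ1 : ‖Ω‖ = 1 := by simp [Ω, Fock.vac, lp.norm_single]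
  have hnt : Nontrivial (Fock.Space w) :=
    ⟨Ω, 0, fun h => by rw [h, norm_zero] at hΩ1; exact zero_ne_one hΩ1⟩
  have hΩ : ∀ h, Fock.a b h Ω = 0 := Fock.a_vac b
  obtain ⟨ρ, hρ⟩ := exists_lift (Fock.isCAR_doubled (Fock.isCAR_a b) hC hST)
  let φ : CARAlgebra H →ₚ[ℂ] ℂ := vectorFunctional ρ Ω
  have hφ : ∀ x y : CARAlgebra H, φ (star x * y) = ⟪ρ x Ω, ρ y Ω⟫_ℂ :=
    vectorFunctional_star_mul ρ Ω
  have hprod : ∀ (n : ℕ) (k : Fin n → H), ρ (List.ofFn fun i => a (k i)).prod Ω =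
      Fock.wedge (Fock.a b) Ω fun i => WithLp.toLp 2 (0, C (T (k i))) := fun n k => by
    rw [← Fock.doubled_prod_vac (S := S) (Fock.isCAR_a b) Ω hΩ k, map_list_prod, List.map_ofFn]
    simp only [Function.comp_def, hρ]
  have hinner : ∀ h k : H, ⟪WithLp.toLp 2 ((0 : H), C (T h)), WithLp.toLp 2 ((0 : H), C (T k))⟫_ℂ =
      ⟪k, K h⟫_ℂ := fun h k => by
    rw [WithLp.prod_inner_apply, hC, hT]; simp
  have htwo : ∀ h k : H, φ (star (a h) * a k) = ⟪k, K h⟫_ℂ := fun h k => by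
    have h1 := hprod 1 fun _ => h
    have h2 := hprod 1 fun _ => k
    simp only [List.ofFn_succ, List.ofFn_zero, List.prod_cons, List.prod_nil, mul_one] at h1 h2
    rw [hφ, h1, h2, Fock.inner_wedge (Fock.isCAR_a b) Ω hΩ hΩ1, Matrix.det_fin_one]
    exact hinner h k
  refine ⟨φ, ?_, fun n h k => ?_, fun n m h k hnm => ?_, htwo⟩
  · have := hφ 1 1
    rw [star_one, one_mul] at this
    rw [this, _root_.map_one ρ]
    change ⟪Ω, Ω⟫_ℂ = 1
    rw [inner_self_eq_norm_sq_to_K, hΩ1]; simp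
  · rw [hφ, hprod, hprod, Fock.inner_wedge (Fock.isCAR_a b) Ω hΩ hΩ1]
    simp only [hinner, htwo]
  · rw [hφ, hprod, hprod, Fock.inner_wedge_of_ne (Fock.isCAR_a b) Ω hΩ hnm]

/-- The quasi-free state `φ_K` associated with a positive contraction `K`. -/
def quasiFreeState [CompleteSpace H] (K : H →L[ℂ] H) (hK₀ : 0 ≤ K) (hK₁ : K ≤ 1) :
    CARAlgebra H →ₚ[ℂ] ℂ :=
  Classical.choose (exists_isQuasiFreeState K hK₀ hK₁)

theorem isQuasiFreeState_quasiFreeState [CompleteSpace H] (K : H →L[ℂ] H) (hK₀ : 0 ≤ K)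
    (hK₁ : K ≤ 1) : IsQuasiFreeState K (quasiFreeState K hK₀ hK₁) :=
  Classical.choose_spec (exists_isQuasiFreeState K hK₀ hK₁)

/-- The restriction of a positive functional to the GICAR algebra. -/
def restrictGICAR (φ : CARAlgebra H →ₚ[ℂ] ℂ) : GICAR H →ₚ[ℂ] ℂ :=
  PositiveLinearMap.mk₀ (φ.toLinearMap ∘ₗ (GICAR.incl (H := H)).toLinearMap) fun x hx => by
    obtain ⟨y, rfl⟩ := CStarAlgebra.nonneg_iff_eq_star_mul_self.1 hx
    change 0 ≤ φ (GICAR.incl (star y * y))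
    rw [map_mul, map_star]
    exact φ.map_nonneg (star_mul_self_nonneg _)

end QuasiFree

/-! ### One-parameter unitary groups and their generators -/

/-- Strongly continuous one-parameter groups of unitary operators. -/
@[ext]
structure UnitaryGroup (E : Type*) [NormedAddCommGroup E] [InnerProductSpace ℂ E] where
  toFun : ℝ → (E ≃ₗᵢ[ℂ] E)
  map_zero : toFun 0 = 1
  map_add : ∀ s t, toFun (s + t) = toFun s * toFun t
  continuous : ∀ x, Continuous fun t => toFun t x

namespace UnitaryGroup
variable {E : Type*} [NormedAddCommGroup E] [InnerProductSpace ℂ E]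

/-- The pairs `(x, y)` with `y = lim (U_t x - x) / (i t)` as `t → 0`. -/
def generatorGraph (U : UnitaryGroup E) : Submodule ℂ (E × E) where
  carrier := {p | Filter.Tendsto (fun t : ℝ => (Complex.I * t)⁻¹ • (U.toFun t p.1 - p.1))
    (nhdsWithin 0 {0}ᶜ) (nhds p.2)}
  zero_mem' := by simp
  add_mem' {p q} hp hq := by
    refine (Filter.Tendsto.add hp hq).congr fun t => ?_
    rw [← smul_add, Prod.fst_add, LinearIsometryEquiv.map_add]
    congr 1
    abel
  smul_mem' c p hp := by
    refine (Filter.Tendsto.const_smul hp c).congr fun t => ?_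
    rw [smul_comm, smul_sub, Prod.smul_fst, LinearIsometryEquiv.map_smul]

/-- The infinitesimal generator: the operator `G` with `U_t = exp(i t G)`. Limits being unique,
`generatorGraph` is the graph of an operator. -/
def generator (U : UnitaryGroup E) : E →ₗ.[ℂ] E := U.generatorGraph.toLinearPMap

theorem generator_graph (U : UnitaryGroup E) : U.generator.graph = U.generatorGraph := by
  refine Submodule.toLinearPMap_graph_eq _ fun p hp h0 => ?_
  have h1 : Filter.Tendsto (fun t : ℝ => (Complex.I * t)⁻¹ • (U.toFun t p.1 - p.1))
    (nhdsWithin 0 {0}ᶜ) (nhds p.2) := hp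
  simp only [h0, LinearIsometryEquiv.map_zero, sub_zero, smul_zero] at h1
  exact tendsto_nhds_unique h1 tendsto_const_nhds

end UnitaryGroup

/-! ### Second quantization in the GNS representation -/

section GNS
variable {H : Type u} [NormedAddCommGroup H] [InnerProductSpace ℂ H]

/-- The GNS cyclic vector. -/
def gnsVector (ψ : GICAR H →ₚ[ℂ] ℂ) : ψ.GNS := ((ψ.toPreGNS 1 : ψ.PreGNS) : ψ.GNS)

/-- `V` is the second quantization of `U` on the GNS space of `ψ`, that is,
`V_t ρ(x) Ω = ρ(γ_{U_t}(x)) Ω` for all `x` in the GICAR algebra. -/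
def IsSecondQuantization (ψ : GICAR H →ₚ[ℂ] ℂ) (U : UnitaryGroup H) (V : UnitaryGroup ψ.GNS) :
    Prop :=
  ∀ (t : ℝ) (x : GICAR H), V.toFun t (ψ.gnsStarAlgHom x (gnsVector ψ)) =
    ψ.gnsStarAlgHom (GICAR.bogoliubov (U.toFun t) x) (gnsVector ψ)

variable {ι : Type*}

/-- The linear span of the vectors `ρ(a*(v_{α₁}) ⋯ a*(v_{αₙ}) a(v_{β₁}) ⋯ a(v_{βₙ})) Ω`, where
`n ≥ 0`, the `αᵢ` are outside of `I₀` and the `βᵢ` are in `I₀`. -/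
def excitationSpan (ψ : GICAR H →ₚ[ℂ] ℂ) (v : ι → H) (I₀ : Set ι) : Submodule ℂ ψ.GNS :=
  Submodule.span ℂ {ξ | ∃ (n : ℕ) (α β : Fin n → ι), (∀ i, α i ∉ I₀) ∧ (∀ i, β i ∈ I₀) ∧
    ξ = ψ.gnsStarAlgHom (GICAR.monomial (fun i => v (α i)) fun i => v (β i)) (gnsVector ψ)}

/-- The pairs `(ξ, η)` with `ξ` in the span of the excitation vectors and
`η = ∑_{α ∉ I₀} m_α ρ(a*(v_α) a(v_α)) ξ - ∑_{α ∈ I₀} m_α ρ(a(v_α) a*(v_α)) ξ`, where both series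
converge. -/
def hamiltonianGraph (ψ : GICAR H →ₚ[ℂ] ℂ) (v : ι → H) (m : ι → ℝ) (I₀ : Set ι) :
    Submodule ℂ (ψ.GNS × ψ.GNS) where
  carrier := {p | p.1 ∈ excitationSpan ψ v I₀ ∧ ∃ y z : ψ.GNS,
    HasSum (fun α : ↥(I₀ᶜ) => (m α : ℂ) • ψ.gnsStarAlgHom (GICAR.creAnn (v α) (v α)) p.1) y ∧
    HasSum (fun α : ↥I₀ => (m α : ℂ) • ψ.gnsStarAlgHom (GICAR.annCre (v α) (v α)) p.1) z ∧
    p.2 = y - z}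
  zero_mem' := ⟨zero_mem _, 0, 0, by simp, by simp, by simp⟩
  add_mem' := by
    rintro p q ⟨hp, y, z, hy, hz, h⟩ ⟨hq, y', z', hy', hz', h'⟩
    refine ⟨add_mem hp hq, y + y', z + z', ?_, ?_, ?_⟩
    · simpa only [Prod.fst_add, map_add, smul_add] using hy.add hy'
    · simpa only [Prod.fst_add, map_add, smul_add] using hz.add hz'
    · rw [Prod.snd_add, h, h']; abel
  smul_mem' := by
    rintro c p ⟨hp, y, z, hy, hz, h⟩
    refine ⟨Submodule.smul_mem _ c hp, c • y, c • z, ?_, ?_, ?_⟩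
    · simpa only [Prod.smul_fst, map_smul, smul_comm c] using hy.const_smul c
    · simpa only [Prod.smul_fst, map_smul, smul_comm c] using hz.const_smul c
    · rw [Prod.smul_snd, h, smul_sub]

/-- The operator
`∑_{α ∉ I₀} m_α ρ(a*(v_α) a(v_α)) - ∑_{α ∈ I₀} m_α ρ(a(v_α) a*(v_α))` on the span of the
excitation vectors. Sums being unique, `hamiltonianGraph` is the graph of an operator. -/
def hamiltonian (ψ : GICAR H →ₚ[ℂ] ℂ) (v : ι → H) (m : ι → ℝ) (I₀ : Set ι) :
    ψ.GNS →ₗ.[ℂ] ψ.GNS :=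
  (hamiltonianGraph ψ v m I₀).toLinearPMap

theorem hamiltonian_graph (ψ : GICAR H →ₚ[ℂ] ℂ) (v : ι → H) (m : ι → ℝ) (I₀ : Set ι) :
    (hamiltonian ψ v m I₀).graph = hamiltonianGraph ψ v m I₀ := by
  refine Submodule.toLinearPMap_graph_eq _ ?_
  rintro p ⟨-, y, z, hy, hz, h⟩ h0
  simp only [h0, map_zero, smul_zero] at hy hz
  rw [h, hy.unique hasSum_zero, hz.unique hasSum_zero, sub_zero]

/-- The orthogonal projection onto the closed linear span of `{v_α : α ∈ I₀}`. -/
def spanProjection [CompleteSpace H] (v : ι → H) (I₀ : Set ι) : H →L[ℂ] H :=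
  (Submodule.span ℂ (v '' I₀)).topologicalClosure.starProjection

theorem spanProjection_nonneg [CompleteSpace H] (v : ι → H) (I₀ : Set ι) :
    0 ≤ spanProjection v I₀ :=
  isStarProjection_starProjection.nonneg

theorem spanProjection_le_one [CompleteSpace H] (v : ι → H) (I₀ : Set ι) :
    spanProjection v I₀ ≤ 1 :=
  isStarProjection_starProjection.le_one

/-- The restriction to the GICAR algebra of the quasi-free state `φ_K`, where `K` is the orthogonal
projection onto the closed linear span of `{v_α : α ∈ I₀}`. -/
def projectionState [CompleteSpace H] (v : ι → H) (I₀ : Set ι) : GICAR H →ₚ[ℂ] ℂ :=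
  restrictGICAR (quasiFreeState (spanProjection v I₀) (spanProjection_nonneg v I₀)
    (spanProjection_le_one v I₀))

end GNS

end

/-! Everything is diagonal. The group `U` multiplies `v α` by `exp(i t m α)`. An excitation vector
with particles `αᵢ ∉ I₀` and holes `βᵢ ∈ I₀` is multiplied by `exp(i t E)` under the second
quantization, with `E = ∑ m αᵢ - ∑ m βᵢ`, and the Hamiltonian sends it to `E` times itself. Hence
all that remains is that a closed symmetric operator `G` with a total family of eigenvectors is the
closure of its restriction to their span (`eq_topologicalClosure_eigenGraph`). The reason is that `G
+ i` controls the graph norm and already maps the span of the eigenvectors onto a dense set. Applied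
to `A` and to the generator of the diagonal group on `H`, this identifies the two, so the general
theorem of Stone is not needed. Applied to the generator of the second quantization, it gives
closability of the Hamiltonian and the formula for its closure.

The work lies in the totality of the excitation vectors. The state `φ_K` is a vacuum in which the
modes of `I₀` are filled: its annihilators `vacAnn` are `a(v i)` for `i ∉ I₀` and `a*(v i)` for `i ∈
I₀`, and all that is needed of `φ_K` beyond positivity is `φ(star (vacAnn i) * vacAnn i) = 0` and
`φ` being a functional on the CAR algebra (`quasiFreeState_vacAnn`). By Cauchy–Schwarz the left
ideal generated by the annihilators is null. Normal ordering shows that words in the creators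
together with this ideal are dense (`topologicalClosure_sup_eq_top`). As `φ` kills the ideal and all
nonempty words, it is invariant under diagonal Bogoliubov transforms (`apply_bogoliubov`), which are
therefore implemented on the GNS space. For the gauge transforms, invariance makes words of nonzero
charge orthogonal to the GICAR algebra, so neutral words suffice (`exists_neutral_norm_sub_lt`).

The eigenvalues of the Hamiltonian come from commuting number operators through words
(`number_mul_word`): what is left over ends in an annihilator of the vacuum and vanishes. -/

noncomputable section

/-! ### Symmetric operators with a total family of eigenvectors -/

section Eigen
variable {E : Type*} [NormedAddCommGroup E] [InnerProductSpace ℂ E] {κ : Type*}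

/-- The linear span of the pairs `(eᵢ, μᵢ eᵢ)`. -/
def eigenGraph (e : κ → E) (μ : κ → ℝ) : Submodule ℂ (E × E) :=
  Submodule.span ℂ (Set.range fun i => (e i, (μ i : ℂ) • e i))

/-- For a symmetric operator `⟪Gx, x⟫` is real, so the cross term in `‖Gx + ix‖²` vanishes and `‖Gx
+ ix‖² = ‖Gx‖² + ‖x‖²`. This dominates the maximum norm of the pair. -/
theorem norm_le_norm_snd_add_I_smul_fst {g : Submodule ℂ (E × E)}
    (hsym : ∀ p ∈ g, ∀ q ∈ g, ⟪p.2, q.1⟫_ℂ = ⟪p.1, q.2⟫_ℂ) {r : E × E} (hr : r ∈ g) :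
    ‖r‖ ≤ ‖r.2 + Complex.I • r.1‖ := by
  have h1 : RCLike.re ⟪r.2, Complex.I • r.1⟫_ℂ = 0 := by
    have h2 := congrArg Complex.im (hsym r hr r hr)
    rw [← inner_conj_symm r.1 r.2, Complex.conj_im] at h2
    have h3 : (⟪r.2, r.1⟫_ℂ).im = 0 := by linarith
    rw [inner_smul_right]
    simp [h3]
  have h2 := norm_add_sq (𝕜 := ℂ) r.2 (Complex.I • r.1)
  rw [h1, norm_smul, Complex.norm_I, one_mul] at h2
  have h3 : ‖r.1‖ ≤ ‖r.2 + Complex.I • r.1‖ := by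
    refine (sq_le_sq₀ (norm_nonneg _) (norm_nonneg _)).1 ?_
    nlinarith [sq_nonneg ‖r.1‖, sq_nonneg ‖r.2‖]
  have h4 : ‖r.2‖ ≤ ‖r.2 + Complex.I • r.1‖ := by
    refine (sq_le_sq₀ (norm_nonneg _) (norm_nonneg _)).1 ?_
    nlinarith [sq_nonneg ‖r.1‖, sq_nonneg ‖r.2‖]
  exact max_le h3 h4

/-- A closed symmetric operator with a total family of eigenvectors is the closure of its
restriction to the span of the eigenvectors. -/
theorem eq_topologicalClosure_eigenGraph {g : Submodule ℂ (E × E)}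
    (hg : IsClosed (g : Set (E × E)))
    (hsym : ∀ p ∈ g, ∀ q ∈ g, ⟪p.2, q.1⟫_ℂ = ⟪p.1, q.2⟫_ℂ) {e : κ → E} {μ : κ → ℝ}
    (he : Dense (Submodule.span ℂ (Set.range e) : Set E))
    (hmem : ∀ i, (e i, (μ i : ℂ) • e i) ∈ g) :
    g = (eigenGraph e μ).topologicalClosure := by
  have hle : eigenGraph e μ ≤ g := Submodule.span_le.2 (by rintro _ ⟨i, rfl⟩; exact hmem i)
  refine le_antisymm (fun p hp => ?_) (Submodule.topologicalClosure_minimal _ hle hg)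
  -- `T` is `G + i` read on the graph. It is bounded below there, so approximating `T p` by images
  -- of eigenvector combinations approximates `p` itself.
  let T : E × E →ₗ[ℂ] E := LinearMap.snd ℂ E E + Complex.I • LinearMap.fst ℂ E E
  have hT : ∀ q, T q = q.2 + Complex.I • q.1 := fun q => rfl
  have hrange : Submodule.span ℂ (Set.range e) ≤ (eigenGraph e μ).map T := by
    refine Submodule.span_le.2 ?_
    rintro _ ⟨i, rfl⟩
    -- Real eigenvalues keep `μ i + i` away from zero, so each `e i` is the image of a multiple of
    -- its own pair.
    have hμ : ((μ i : ℂ) + Complex.I) ≠ 0 := fun h => by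
      have := congrArg Complex.im h; simp at this
    refine ⟨((μ i : ℂ) + Complex.I)⁻¹ • (e i, (μ i : ℂ) • e i),
      Submodule.smul_mem _ _ (Submodule.subset_span ⟨i, rfl⟩), ?_⟩
    rw [map_smul, hT, ← add_smul, smul_smul, inv_mul_cancel₀ hμ, one_smul]
  refine Metric.mem_closure_iff.2 fun ε hε => ?_
  obtain ⟨y, hy, hlt⟩ := Metric.mem_closure_iff.1 (he (T p)) ε hε
  obtain ⟨q, hq, rfl⟩ := hrange hy
  refine ⟨q, hq, lt_of_le_of_lt ?_ hlt⟩
  rw [dist_eq_norm, dist_eq_norm, ← map_sub]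
  exact norm_le_norm_snd_add_I_smul_fst hsym (sub_mem hp (hle hq))

theorem LinearIsometryEquiv.ext_of_dense_span {e : κ → E}
    (he : Dense (Submodule.span ℂ (Set.range e) : Set E)) {F G : E ≃ₗᵢ[ℂ] E}
    (h : ∀ i, F (e i) = G (e i)) : F = G := by
  ext x
  have h1 : (F.toContinuousLinearEquiv : E →L[ℂ] E) = G.toContinuousLinearEquiv :=
    ContinuousLinearMap.ext_on he (by rintro _ ⟨i, rfl⟩; exact h i)
  exact congrArg (fun T : E →L[ℂ] E => T x) h1

end Eigen

/-! ### Generators of unitary groups: symmetry, closedness, eigenvectors -/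

namespace UnitaryGroup
variable {E : Type*} [NormedAddCommGroup E] [InnerProductSpace ℂ E]

theorem apply_zero (U : UnitaryGroup E) (x : E) : U.toFun 0 x = x := by rw [U.map_zero]; rfl

theorem apply_add (U : UnitaryGroup E) (s t : ℝ) (x : E) :
    U.toFun (s + t) x = U.toFun s (U.toFun t x) := by rw [U.map_add]; rfl

theorem inner_apply_left (U : UnitaryGroup E) (t : ℝ) (x y : E) :
    ⟪U.toFun t x, y⟫_ℂ = ⟪x, U.toFun (-t) y⟫_ℂ := by
  rw [← (U.toFun (-t)).inner_map_map (U.toFun t x) y, ← U.apply_add, neg_add_cancel, U.apply_zero]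

theorem mem_generatorGraph {U : UnitaryGroup E} {p : E × E} : p ∈ U.generatorGraph ↔
    Filter.Tendsto (fun t : ℝ => (Complex.I * t)⁻¹ • (U.toFun t p.1 - p.1))
      (nhdsWithin 0 {0}ᶜ) (nhds p.2) := Iff.rfl

theorem inner_generatorGraph (U : UnitaryGroup E) {p q : E × E} (hp : p ∈ U.generatorGraph)
    (hq : q ∈ U.generatorGraph) : ⟪p.2, q.1⟫_ℂ = ⟪p.1, q.2⟫_ℂ := by
  rw [mem_generatorGraph] at hp hq
  -- Moving the quotient at `t` to the other side of the inner product turns it into the quotient at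
  -- `-t`, because the conjugate of `(i t)⁻¹` is `(i (-t))⁻¹`.
  have hneg : Filter.Tendsto (fun t : ℝ => -t) (nhdsWithin 0 {0}ᶜ) (nhdsWithin 0 {0}ᶜ) := by
    refine tendsto_nhdsWithin_iff.2 ⟨?_, ?_⟩
    · simpa using (continuous_neg.tendsto (0 : ℝ)).mono_left nhdsWithin_le_nhds
    · filter_upwards [self_mem_nhdsWithin] with t ht
      simpa using ht
  have h1 := hp.inner (𝕜 := ℂ) (tendsto_const_nhds (x := q.1))
  have h2 := (tendsto_const_nhds (x := p.1)).inner (𝕜 := ℂ) (hq.comp hneg)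
  refine tendsto_nhds_unique (h1.congr fun t => ?_) h2
  simp only [Function.comp, inner_smul_left, inner_smul_right, inner_sub_left, inner_sub_right,
    U.inner_apply_left]
  simp

theorem hasDerivAt_apply (U : UnitaryGroup E) {p : E × E} (hp : p ∈ U.generatorGraph) (s : ℝ) :
    HasDerivAt (fun t => U.toFun t p.1) (Complex.I • U.toFun s p.2) s := by
  rw [hasDerivAt_iff_tendsto_slope_zero]
  have h1 := (((U.toFun s).continuous.tendsto _).comp hp).const_smul Complex.I
  refine h1.congr fun t => ?_
  simp only [Function.comp, map_smul, smul_smul, map_sub, U.apply_add]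
  rw [mul_inv, ← mul_assoc, mul_inv_cancel₀ Complex.I_ne_zero, one_mul, ← Complex.ofReal_inv,
    Complex.coe_smul]

/-- The difference quotient at `t` differs from the generator by at most the oscillation of the
orbit over times up to `t`. -/
theorem norm_apply_sub_sub_le (U : UnitaryGroup E) {p : E × E} (hp : p ∈ U.generatorGraph)
    {t c : ℝ} (hc : ∀ s, |s| ≤ |t| → ‖U.toFun s p.2 - p.2‖ ≤ c) :
    ‖U.toFun t p.1 - p.1 - (Complex.I * t) • p.2‖ ≤ c * |t| := by
  have hd : ∀ s ∈ Set.Icc (-|t|) |t|,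
      HasDerivWithinAt (fun s : ℝ => U.toFun s p.1 - (Complex.I * s) • p.2)
        (Complex.I • (U.toFun s p.2 - p.2)) (Set.Icc (-|t|) |t|) s := fun s _ => by
    have h1 : HasDerivAt (fun s : ℝ => (Complex.I * s) • p.2) ((Complex.I * 1) • p.2) s :=
      ((Complex.ofRealCLM.hasDerivAt (x := s)).const_mul Complex.I).smul_const p.2
    have h2 := (U.hasDerivAt_apply hp s).sub h1
    rw [mul_one, ← smul_sub] at h2
    exact h2.hasDerivWithinAt
  have h := Convex.norm_image_sub_le_of_norm_hasDerivWithin_le (x := 0) (y := t) (C := c) hd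
    (fun s hs => by
      rw [norm_smul, Complex.norm_I, one_mul]; exact hc s (abs_le.2 hs)) (convex_Icc _ _)
    ⟨by simp, by simp⟩ ⟨neg_abs_le t, le_abs_self t⟩
  simp only [U.apply_zero, Complex.ofReal_zero, mul_zero, zero_smul, sub_zero,
    Real.norm_eq_abs] at h
  rwa [sub_right_comm] at h

/-- The bound of `norm_apply_sub_sub_le` survives limits of pairs in the graph, and together with
strong continuity it forces the difference quotients to converge. This replaces the usual integral
formula for `U_t x - x`. -/
theorem isClosed_generatorGraph (U : UnitaryGroup E) :
    IsClosed (U.generatorGraph : Set (E × E)) := by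
  refine isClosed_of_closure_subset fun p hp => ?_
  -- For a pair `q` of the graph close to `p`, the oscillation of the orbit of `q.2` exceeds that of
  -- `p.2` by at most `2 ‖q.2 - p.2‖`, uniformly in time, since `U_s` is isometric.
  have key : ∀ (t c : ℝ), (∀ s, |s| ≤ |t| → ‖U.toFun s p.2 - p.2‖ ≤ c) →
      ‖U.toFun t p.1 - p.1 - (Complex.I * t) • p.2‖ ≤ c * |t| := fun t c hc => by
    obtain ⟨q, hq, hlim⟩ := mem_closure_iff_seq_limit.1 hp
    have h1 : Filter.Tendsto (fun n => (q n).1) Filter.atTop (nhds p.1) :=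
      (continuous_fst.tendsto p).comp hlim
    have h2 : Filter.Tendsto (fun n => (q n).2) Filter.atTop (nhds p.2) :=
      (continuous_snd.tendsto p).comp hlim
    have h3 := ((((U.toFun t).continuous.tendsto _).comp h1).sub h1).sub
      (h2.const_smul (Complex.I * t))
    have h4 : Filter.Tendsto (fun n => (c + 2 * ‖(q n).2 - p.2‖) * |t|) Filter.atTop
        (nhds ((c + 2 * 0) * |t|)) := by
      have := (tendsto_iff_norm_sub_tendsto_zero.1 h2)
      exact (tendsto_const_nhds.add (this.const_mul 2)).mul_const _
    rw [mul_zero, add_zero] at h4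
    refine le_of_tendsto_of_tendsto' h3.norm h4 fun n => ?_
    refine U.norm_apply_sub_sub_le (hq n) fun s hs => ?_
    have h5 : U.toFun s (q n).2 - (q n).2 =
        (U.toFun s p.2 - p.2) + (U.toFun s ((q n).2 - p.2) - ((q n).2 - p.2)) := by
      rw [map_sub]; abel
    rw [h5]
    have h6 := norm_sub_le (U.toFun s ((q n).2 - p.2)) ((q n).2 - p.2)
    rw [LinearIsometryEquiv.norm_map] at h6
    have h7 := norm_add_le (U.toFun s p.2 - p.2)
      (U.toFun s ((q n).2 - p.2) - ((q n).2 - p.2))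
    linarith [hc s hs]
  change p ∈ U.generatorGraph
  rw [mem_generatorGraph, Metric.tendsto_nhdsWithin_nhds]
  intro ε hε
  obtain ⟨δ, hδ, h⟩ := Metric.continuous_iff.1 (U.continuous p.2) 0 (ε / 2) (by positivity)
  refine ⟨δ, hδ, fun {t} ht htδ => ?_⟩
  have ht0 : t ≠ 0 := ht
  rw [Real.dist_0_eq_abs] at htδ
  have h1 := key t (ε / 2) fun s hs => by
    have := h s (by rw [Real.dist_0_eq_abs]; exact hs.trans_lt htδ)
    rw [U.apply_zero, dist_eq_norm] at this
    exact this.le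
  have hne : Complex.I * (t : ℂ) ≠ 0 := mul_ne_zero Complex.I_ne_zero (by exact_mod_cast ht0)
  have h2 : (Complex.I * t)⁻¹ • (U.toFun t p.1 - p.1) - p.2 =
      (Complex.I * t)⁻¹ • (U.toFun t p.1 - p.1 - (Complex.I * t) • p.2) := by
    rw [smul_sub _ _ ((Complex.I * (t : ℂ)) • p.2), smul_smul, inv_mul_cancel₀ hne, one_smul]
  rw [dist_eq_norm, h2, norm_smul, norm_inv, norm_mul, Complex.norm_I, one_mul, Complex.norm_real,
    Real.norm_eq_abs]
  have ht1 : 0 < |t| := abs_pos.2 ht0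
  calc |t|⁻¹ * _ ≤ |t|⁻¹ * (ε / 2 * |t|) := by gcongr
    _ = ε / 2 := by field_simp
    _ < ε := by linarith

/-- The curve `exp(-i t μ) U_t x` has derivative zero, hence keeps its value at `t = 0`. -/
theorem apply_eq_exp_smul (U : UnitaryGroup E) {x : E} {μ : ℝ}
    (h : (x, (μ : ℂ) • x) ∈ U.generatorGraph) (t : ℝ) :
    U.toFun t x = Complex.exp (Complex.I * t * μ) • x := by
  have hd : ∀ s : ℝ, HasDerivAt (fun s : ℝ => Complex.exp (-(Complex.I * s * μ)) • U.toFun s x)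
      0 s := fun s => by
    have h1 : HasDerivAt (fun s : ℝ => -(Complex.I * s * μ)) (-(Complex.I * 1 * μ)) s :=
      (((Complex.ofRealCLM.hasDerivAt (x := s)).const_mul Complex.I).mul_const (μ : ℂ)).neg
    have h2 := h1.cexp.smul (U.hasDerivAt_apply h s)
    have h3 : Complex.exp (-(Complex.I * s * μ)) • Complex.I • U.toFun s ((μ : ℂ) • x) +
        (Complex.exp (-(Complex.I * s * μ)) * -(Complex.I * 1 * μ)) • U.toFun s x = 0 := by
      rw [map_smul, smul_smul, smul_smul, ← add_smul]
      convert zero_smul ℂ _ using 2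
      ring
    rw [h3] at h2
    exact h2
  have h1 := is_const_of_deriv_eq_zero (fun s => (hd s).differentiableAt)
    (fun s => (hd s).deriv) t 0
  simp only [Complex.ofReal_zero, mul_zero, zero_mul, neg_zero, Complex.exp_zero, one_smul,
    U.apply_zero] at h1
  nth_rewrite 2 [← h1]
  rw [smul_smul, ← Complex.exp_add, add_neg_cancel, Complex.exp_zero, one_smul]

theorem mem_generatorGraph_of_apply_eq (U : UnitaryGroup E) {x : E} {μ : ℝ}
    (h : ∀ t : ℝ, U.toFun t x = Complex.exp (Complex.I * t * μ) • x) :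
    (x, (μ : ℂ) • x) ∈ U.generatorGraph := by
  have h1 : HasDerivAt (fun s : ℝ => Complex.I * s * μ) (Complex.I * 1 * μ) 0 :=
    ((Complex.ofRealCLM.hasDerivAt (x := (0 : ℝ))).const_mul Complex.I).mul_const (μ : ℂ)
  have h2 := hasDerivAt_iff_tendsto_slope_zero.1 (h1.cexp.smul_const x)
  have h3 := h2.const_smul Complex.I⁻¹
  rw [mem_generatorGraph]
  convert h3 using 2 with t
  · simp only [h, zero_add, Complex.ofReal_zero, mul_zero, zero_mul, Complex.exp_zero, one_smul]
    rw [← Complex.coe_smul, smul_smul, Complex.ofReal_inv, mul_inv]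
  · rw [smul_smul]
    simp [← mul_assoc]

variable {κ : Type*} {e : κ → E} {μ : κ → ℝ}

/-- The generator of a unitary group with a total family of eigenvectors. -/
theorem graph_generator_eq (U : UnitaryGroup E)
    (he : Dense (Submodule.span ℂ (Set.range e) : Set E))
    (h : ∀ (t : ℝ) i, U.toFun t (e i) = Complex.exp (Complex.I * t * μ i) • e i) :
    U.generator.graph = (eigenGraph e μ).topologicalClosure := by
  rw [generator_graph]
  exact eq_topologicalClosure_eigenGraph U.isClosed_generatorGraph
    (fun p hp q hq => U.inner_generatorGraph hp hq) he
    fun i => U.mem_generatorGraph_of_apply_eq fun t => h t i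

/-- Unitary operators that are diagonal with entries `exp(i t μ)` in a total family form a strongly
continuous group. -/
theorem exists_toFun_eq {F : ℝ → (E ≃ₗᵢ[ℂ] E)}
    (he : Dense (Submodule.span ℂ (Set.range e) : Set E))
    (h : ∀ (t : ℝ) i, F t (e i) = Complex.exp (Complex.I * t * μ i) • e i) :
    ∃ U : UnitaryGroup E, U.toFun = F := by
  refine ⟨⟨F, LinearIsometryEquiv.ext_of_dense_span he fun i => by simp [h], fun s t =>
    LinearIsometryEquiv.ext_of_dense_span he fun i => ?_, fun x => ?_⟩, rfl⟩
  · change F (s + t) (e i) = F s (F t (e i))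
    rw [h, h, map_smul, h, smul_smul, ← Complex.exp_add]
    congr 2
    push_cast
    ring
  -- Continuity is evident on eigenvectors and their combinations. It passes to all vectors by an `ε
  -- / 3` argument because every `F t` is an isometry.
  · have hc : ∀ y ∈ Submodule.span ℂ (Set.range e), Continuous fun t => F t y := fun y hy => by
      induction hy using Submodule.span_induction with
      | mem y hy =>
        obtain ⟨i, rfl⟩ := hy
        simp only [h]
        fun_prop
      | zero => simpa using continuous_const
      | add y z _ _ hy hz => exact (hy.add hz).congr fun t => ((F t).map_add y z).symm
      | smul c y _ hy => simp only [map_smul]; exact hy.const_smul c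
    refine Metric.continuous_iff.2 fun t ε hε => ?_
    obtain ⟨y, hy, hxy⟩ := Metric.mem_closure_iff.1 (he x) (ε / 3) (by positivity)
    obtain ⟨δ, hδ, hd⟩ := Metric.continuous_iff.1 (hc y hy) t (ε / 3) (by positivity)
    refine ⟨δ, hδ, fun s hs => ?_⟩
    calc dist (F s x) (F t x) ≤ dist (F s x) (F s y) + dist (F s y) (F t y) +
          dist (F t y) (F t x) := dist_triangle4 _ _ _ _
      _ < ε / 3 + ε / 3 + ε / 3 := by
        rw [(F s).dist_map, (F t).dist_map, dist_comm y x]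
        gcongr
        exact hd s hs
      _ = ε := by ring

end UnitaryGroup

/-! ### The diagonal group on the one-particle space -/

section Hilbert
variable {H : Type*} [NormedAddCommGroup H] [InnerProductSpace ℂ H] {ι : Type*}

theorem HilbertBasis.dense_span_range (v : HilbertBasis ι ℂ H) :
    Dense (Submodule.span ℂ (Set.range v) : Set H) :=
  Submodule.dense_iff_topologicalClosure_eq_top.2 v.dense_span

theorem exists_unitaryGroup_diagonal [CompleteSpace H] (v : HilbertBasis ι ℂ H) (m : ι → ℝ) :
    ∃ U : UnitaryGroup H, ∀ (t : ℝ) i,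
      U.toFun t (v i) = Complex.exp (Complex.I * t * m i) • v i := by
  classical
  have hF : ∀ t : ℝ, ∃ F : H ≃ₗᵢ[ℂ] H, ∀ i, F (v i) = Complex.exp (Complex.I * t * m i) • v i := by
    intro t
    have hn : ∀ i, ‖Complex.exp (Complex.I * t * m i)‖ = 1 := fun i => by
      rw [mul_assoc, mul_comm, ← Complex.ofReal_mul, Complex.norm_exp_ofReal_mul_I]
    have ho : Orthonormal ℂ fun i => Complex.exp (Complex.I * t * m i) • v i := by
      refine ⟨fun i => by rw [norm_smul, hn, v.orthonormal.1 i, one_mul], fun i j hij => ?_⟩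
      change ⟪_ • v i, _ • v j⟫_ℂ = 0
      rw [inner_smul_left, inner_smul_right, v.orthonormal.2 hij, mul_zero, mul_zero]
    have hsp : ⊤ ≤ (Submodule.span ℂ
        (Set.range fun i => Complex.exp (Complex.I * t * m i) • v i)).topologicalClosure := by
      rw [← v.dense_span]
      refine Submodule.topologicalClosure_mono (Submodule.span_le.2 ?_)
      rintro _ ⟨i, rfl⟩
      have := Submodule.smul_mem _ (Complex.exp (Complex.I * t * m i))⁻¹ (Submodule.subset_span
        (R := ℂ) (Set.mem_range_self (f := fun i => Complex.exp (Complex.I * t * m i) • v i) i))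
      rwa [smul_smul, inv_mul_cancel₀ (Complex.exp_ne_zero _), one_smul] at this
    let w := HilbertBasis.mk ho hsp
    -- Multiplying the basis by phases gives another Hilbert basis `w`; the unitary is the change of
    -- basis from `v` to `w`.
    refine ⟨v.repr.trans w.repr.symm, fun i => ?_⟩
    rw [LinearIsometryEquiv.trans_apply, v.repr_self, w.repr_symm_single]
    exact congrFun (HilbertBasis.coe_mk ho hsp) i
  choose F hF using hF
  obtain ⟨U, hU⟩ := UnitaryGroup.exists_toFun_eq v.dense_span_range hF
  exact ⟨U, fun t i => by rw [hU, hF]⟩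

variable {A : H →ₗ.[ℂ] H} {v : HilbertBasis ι ℂ H} {m : ι → ℝ}

theorem UnitaryGroup.apply_basis_of_generator_eq
    (hv : ∀ α, ∃ hα : v α ∈ A.domain, A ⟨v α, hα⟩ = (m α : ℂ) • v α) {U : UnitaryGroup H}
    (hU : U.generator = A) (t : ℝ) (α : ι) :
    U.toFun t (v α) = Complex.exp (Complex.I * t * m α) • v α := by
  refine U.apply_eq_exp_smul ?_ t
  rw [← U.generator_graph, hU]
  obtain ⟨hα, h⟩ := hv α
  rw [← h]
  exact A.mem_graph ⟨v α, hα⟩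

/-- The diagonal group has a closed symmetric generator with the same total family of eigenvectors
and eigenvalues as `A`, so both are the closure of the same eigenvector graph. Uniqueness holds
because the generator fixes the phases on the basis. -/
theorem existsUnique_generator_eq [CompleteSpace H] (hA : IsSelfAdjoint A)
    (hv : ∀ α, ∃ hα : v α ∈ A.domain, A ⟨v α, hα⟩ = (m α : ℂ) • v α) :
    ∃! U : UnitaryGroup H, U.generator = A := by
  obtain ⟨U, hU⟩ := exists_unitaryGroup_diagonal v m
  refine ⟨U, LinearPMap.eq_of_eq_graph ?_, fun W hW => ?_⟩
  · rw [U.graph_generator_eq v.dense_span_range hU]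
    refine (eq_topologicalClosure_eigenGraph hA.isClosed ?_ v.dense_span_range fun α => ?_).symm
    · intro p hp q hq
      obtain ⟨x, hx, hx'⟩ := A.mem_graph_iff.1 hp
      obtain ⟨y, hy, hy'⟩ := A.mem_graph_iff.1 hq
      have h := LinearPMap.adjoint_isFormalAdjoint hA.dense_domain
      rw [LinearPMap.isSelfAdjoint_def.1 hA] at h
      rw [← hx, ← hx', ← hy, ← hy']
      exact h x y
    · obtain ⟨hα, h⟩ := hv α
      rw [← h]
      exact A.mem_graph ⟨v α, hα⟩
  · refine UnitaryGroup.ext (funext fun t => LinearIsometryEquiv.ext_of_dense_span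
      v.dense_span_range fun α => ?_)
    rw [hU, W.apply_basis_of_generator_eq hv hW]

end Hilbert

/-! ### Moving an element through a product -/

theorem List.mul_prod_of_anticomm {R : Type*} [Ring R] {z : R} {l : List R}
    (h : ∀ x ∈ l, z * x = -(x * z)) : z * l.prod = (-1) ^ l.length * (l.prod * z) := by
  induction l with
  | nil => simp
  | cons x l ih =>
    rw [List.prod_cons, ← mul_assoc, h x List.mem_cons_self, neg_mul, mul_assoc,
      ih fun y hy => h y (List.mem_cons_of_mem _ hy), List.length_cons, pow_succ,
      ((Commute.neg_one_left x).pow_left _).symm.left_comm]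
    simp [mul_assoc]

/-- The commutator with `z` is a derivation, so its eigenvalues add up along a product. -/
theorem List.mul_prod_of_commutator {𝕜 R J : Type*} [CommRing 𝕜] [Ring R] [Algebra 𝕜 R] {z : R}
    {f : J → R} {c : J → 𝕜} {l : List J} (h : ∀ j ∈ l, z * f j = f j * z + c j • f j) :
    z * (l.map f).prod = (l.map f).prod * z + (l.map c).sum • (l.map f).prod := by
  induction l with
  | nil => simp
  | cons j l ih =>
    simp only [List.map_cons, List.prod_cons, List.sum_cons]
    rw [← mul_assoc, h j List.mem_cons_self, add_mul, mul_assoc,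
      ih fun k hk => h k (List.mem_cons_of_mem _ hk), mul_add, mul_smul_comm, smul_mul_assoc,
      add_smul, mul_assoc]
    abel

/-! ### Density of the polynomials in the generators -/

namespace CARAlgebra
variable {H : Type u} [NormedAddCommGroup H] [InnerProductSpace ℂ H]

/-- The CAR algebra is by construction a closure taken inside the product of all representations.
Here the density is transferred to the subspace topology of the algebra itself. -/
theorem topologicalClosure_adjoin_range_a :
    (StarAlgebra.adjoin ℂ (Set.range (a (H := H)))).topologicalClosure = ⊤ := by
  let j : CARAlgebra H →⋆ₐ[ℂ] CARProd H := (CARProd.carSubalgebra H).subtype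
  refine eq_top_iff.2 fun x _ => ?_
  change x ∈ closure (StarAlgebra.adjoin ℂ (Set.range (a (H := H))) : Set (CARAlgebra H))
  have h1 : (StarAlgebra.adjoin ℂ (Set.range (a (H := H)))).map j =
      StarAlgebra.adjoin ℂ (Set.range (CARProd.a (H := H))) := by
    rw [StarAlgHom.map_adjoin, ← Set.range_comp]
    rfl
  refine (closure_subtype (p := fun y => y ∈ CARProd.carSubalgebra H)).2 ?_
  have h2 : (x.1 : CARProd H) ∈
      closure (StarAlgebra.adjoin ℂ (Set.range (CARProd.a (H := H))) : Set (CARProd H)) := x.2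
  rw [← h1] at h2
  exact h2

/-- A closed subspace that contains `1` and is invariant under left multiplication by the
generators is the whole algebra. -/
theorem eq_top_of_mul_mem {C : Submodule ℂ (CARAlgebra H)}
    (hC : IsClosed (C : Set (CARAlgebra H))) (h1 : 1 ∈ C) (ha : ∀ h, ∀ c ∈ C, a h * c ∈ C)
    (ha' : ∀ h, ∀ c ∈ C, star (a h) * c ∈ C) : C = ⊤ := by
  -- Invariance is proved for `x` and `star x` together, so that the induction passes through
  -- adjoints.
  have key : ∀ x ∈ StarAlgebra.adjoin ℂ (Set.range (a (H := H))),
      (∀ c ∈ C, x * c ∈ C) ∧ ∀ c ∈ C, star x * c ∈ C := fun x hx => by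
    induction hx using StarAlgebra.adjoin_induction with
    | mem x hx => obtain ⟨h, rfl⟩ := hx; exact ⟨ha h, ha' h⟩
    | algebraMap r =>
      refine ⟨fun c hc => ?_, fun c hc => ?_⟩
      · rw [← Algebra.smul_def]; exact C.smul_mem r hc
      · rw [← algebraMap_star_comm, ← Algebra.smul_def]; exact C.smul_mem _ hc
    | add x y _ _ hx hy =>
      refine ⟨fun c hc => ?_, fun c hc => ?_⟩
      · rw [add_mul]; exact C.add_mem (hx.1 c hc) (hy.1 c hc)
      · rw [star_add, add_mul]; exact C.add_mem (hx.2 c hc) (hy.2 c hc)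
    | mul x y _ _ hx hy =>
      refine ⟨fun c hc => ?_, fun c hc => ?_⟩
      · rw [mul_assoc]; exact hx.1 _ (hy.1 c hc)
      · rw [star_mul, mul_assoc]; exact hy.2 _ (hx.2 c hc)
    | star x _ hx => exact ⟨hx.2, by rw [star_star]; exact hx.1⟩
  refine eq_top_iff.2 fun x _ => ?_
  have hx : x ∈ (StarAlgebra.adjoin ℂ (Set.range (a (H := H)))).topologicalClosure := by
    rw [topologicalClosure_adjoin_range_a]; trivial
  refine closure_minimal (fun y hy => ?_) hC hx
  simpa using (key y hy).1 1 h1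

theorem continuous_a : Continuous (a : H → CARAlgebra H) :=
  AddMonoidHomClass.continuous_of_bound (a : H →ₗ⋆[ℂ] CARAlgebra H) 1 fun h => by
    rw [one_mul]; exact isCAR_a.norm_le h

theorem mul_mem_of_dense_span {κ : Type*} {e : κ → H}
    (he : Dense (Submodule.span ℂ (Set.range e) : Set H)) {C : Submodule ℂ (CARAlgebra H)}
    (hC : IsClosed (C : Set (CARAlgebra H))) {c : CARAlgebra H}
    (h1 : ∀ i, a (e i) * c ∈ C) (h2 : ∀ i, star (a (e i)) * c ∈ C) (h : H) :
    a h * c ∈ C ∧ star (a h) * c ∈ C := by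
  have hcl : IsClosed {h : H | a h * c ∈ C ∧ star (a h) * c ∈ C} :=
    (hC.preimage (continuous_a.mul continuous_const)).inter
      (hC.preimage (continuous_a.star.mul continuous_const))
  refine closure_minimal (s := (Submodule.span ℂ (Set.range e) : Set H)) (fun y hy => ?_) hcl
    (he h)
  induction hy using Submodule.span_induction with
  | mem y hy => obtain ⟨i, rfl⟩ := hy; exact ⟨h1 i, h2 i⟩
  | zero => simp
  | add y z _ _ hy hz =>
    simp only [Set.mem_ofPred_eq, map_add, star_add, add_mul]
    exact ⟨C.add_mem hy.1 hz.1, C.add_mem hy.2 hz.2⟩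
  | smul r y _ hy =>
    simp only [Set.mem_ofPred_eq, map_smulₛₗ, star_smul, smul_mul_assoc]
    exact ⟨C.smul_mem _ hy.1, C.smul_mem _ hy.2⟩

/-! ### Normal ordering relative to the vacuum with the modes of `I₀` filled -/

section Words
variable {ι : Type*} (v : ι → H) (I₀ : Set ι)

open Classical in
/-- The annihilation operators of the quasi-free vacuum in which exactly the modes in `I₀` are
occupied. -/
def vacAnn (i : ι) : CARAlgebra H := if i ∈ I₀ then star (a (v i)) else a (v i)

/-- The left ideal generated by the annihilation operators of the vacuum. -/
def vacIdeal : Submodule ℂ (CARAlgebra H) :=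
  Submodule.span ℂ {y | ∃ x i, y = x * vacAnn v I₀ i}

/-- The element `a*(v_{α₁}) ⋯ a*(v_{αₙ}) a(v_{β₁}) ⋯ a(v_{βₘ})`. -/
def word (α β : List ι) : CARAlgebra H :=
  (α.map fun i => star (a (v i))).prod * (β.map fun i => a (v i)).prod

/-- The span of the words in the creation operators of the vacuum. -/
def wordSpan : Submodule ℂ (CARAlgebra H) :=
  Submodule.span ℂ {w | ∃ α β : List ι, (∀ i ∈ α, i ∉ I₀) ∧ (∀ i ∈ β, i ∈ I₀) ∧ w = word v α β}

variable {v I₀}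

theorem vacAnn_of_mem {i : ι} (hi : i ∈ I₀) : vacAnn v I₀ i = star (a (v i)) := if_pos hi

theorem vacAnn_of_notMem {i : ι} (hi : i ∉ I₀) : vacAnn v I₀ i = a (v i) := if_neg hi

theorem mul_vacAnn_mem (x : CARAlgebra H) (i : ι) : x * vacAnn v I₀ i ∈ vacIdeal v I₀ :=
  Submodule.subset_span ⟨x, i, rfl⟩

theorem mul_mem_vacIdeal (x : CARAlgebra H) {y : CARAlgebra H} (hy : y ∈ vacIdeal v I₀) :
    x * y ∈ vacIdeal v I₀ := by
  induction hy using Submodule.span_induction with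
  | mem y hy => obtain ⟨z, i, rfl⟩ := hy; rw [← mul_assoc]; exact mul_vacAnn_mem _ i
  | zero => rw [mul_zero]; exact zero_mem _
  | add y z _ _ hy hz => rw [mul_add]; exact add_mem hy hz
  | smul c y _ hy => rw [mul_smul_comm]; exact Submodule.smul_mem _ c hy

theorem word_mem {α β : List ι} (hα : ∀ i ∈ α, i ∉ I₀) (hβ : ∀ i ∈ β, i ∈ I₀) :
    word v α β ∈ wordSpan v I₀ := Submodule.subset_span ⟨α, β, hα, hβ, rfl⟩

theorem word_cons_left (j : ι) (α β : List ι) :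
    word v (j :: α) β = star (a (v j)) * word v α β := by
  simp [word, mul_assoc]

theorem word_nil_cons (j : ι) (β : List ι) : word v [] (j :: β) = a (v j) * word v [] β := by
  simp [word]

theorem star_a_mul_a_of_ne (hv : Orthonormal ℂ v) {i j : ι} (h : i ≠ j) :
    star (a (v i)) * a (v j) = -(a (v j) * star (a (v i))) := by
  have := isCAR_a.anticomm_star (v i) (v j)
  rw [hv.2 h.symm, map_zero] at this
  exact eq_neg_of_add_eq_zero_left this

theorem star_a_mul_a_self (hv : Orthonormal ℂ v) (i : ι) :
    star (a (v i)) * a (v i) = 1 - a (v i) * star (a (v i)) := by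
  have := isCAR_a.anticomm_star (v i) (v i)
  rw [inner_self_eq_norm_sq_to_K, hv.1 i] at this
  rw [eq_sub_iff_add_eq, this]
  simp

/-- A creator `a*(v i)` with `i ∉ I₀` is simply prepended. A creator `a(v i)` with `i ∈ I₀` first
passes the block of the `a*(v j)`, with which it anticommutes because `j ∉ I₀`. -/
theorem star_vacAnn_mul_mem (hv : Orthonormal ℂ v) (i : ι) {w : CARAlgebra H} (hw : w ∈ wordSpan v I₀) :
    star (vacAnn v I₀ i) * w ∈ wordSpan v I₀ := by
  induction hw using Submodule.span_induction with
  | mem w hw =>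
    obtain ⟨α, β, hα, hβ, rfl⟩ := hw
    by_cases hi : i ∈ I₀
    -- The sign `(-1) ^ length` is turned into an integer multiple, under which the span is closed.
    · rw [vacAnn_of_mem hi, star_star, word, ← mul_assoc,
        List.mul_prod_of_anticomm (l := α.map fun i => star (a (v i))), mul_assoc,
        mul_assoc, ← List.prod_cons, ← List.map_cons (f := fun i => a (v i)),
        ← Int.cast_one, ← Int.cast_neg, ← Int.cast_pow, ← zsmul_eq_mul]
      · exact zsmul_mem (word_mem hα fun j hj => by
          rcases List.mem_cons.1 hj with rfl | hj
          exacts [hi, hβ j hj]) _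
      · intro x hx
        obtain ⟨j, hj, rfl⟩ := List.mem_map.1 hx
        rw [star_a_mul_a_of_ne hv (i := j) (j := i) (fun h => hα j hj (h ▸ hi)), neg_neg]
    · rw [vacAnn_of_notMem hi, ← word_cons_left]
      exact word_mem (fun j hj => by
        rcases List.mem_cons.1 hj with rfl | hj
        exacts [hi, hα j hj]) hβ
  | zero => rw [mul_zero]; exact zero_mem _
  | add y z _ _ hy hz => rw [mul_add]; exact add_mem hy hz
  | smul c y _ hy => rw [mul_smul_comm]; exact Submodule.smul_mem _ c hy

/-- Exchanging `a` and `a*` on the modes of `I₀` preserves the anticommutation relations: mixed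
pairs anticommute, and pairs of one kind have a scalar anticommutator. -/
theorem vacAnn_mul_star_vacAnn (i j : ι) : ∃ c : ℂ,
    vacAnn v I₀ i * star (vacAnn v I₀ j) =
      c • (1 : CARAlgebra H) - star (vacAnn v I₀ j) * vacAnn v I₀ i := by
  simp only [← Algebra.algebraMap_eq_smul_one]
  by_cases hi : i ∈ I₀ <;> by_cases hj : j ∈ I₀
  · rw [vacAnn_of_mem hi, vacAnn_of_mem hj, star_star]
    exact ⟨_, eq_sub_of_add_eq (isCAR_a.anticomm_star (v i) (v j))⟩
  · refine ⟨0, ?_⟩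
    rw [vacAnn_of_mem hi, vacAnn_of_notMem hj, map_zero, zero_sub, ← star_mul, ← star_mul,
      eq_neg_of_add_eq_zero_left (isCAR_a.anticomm (v j) (v i)), star_neg]
  · refine ⟨0, ?_⟩
    rw [vacAnn_of_notMem hi, vacAnn_of_mem hj, map_zero, zero_sub, star_star,
      eq_neg_of_add_eq_zero_left (isCAR_a.anticomm (v i) (v j))]
  · rw [vacAnn_of_notMem hi, vacAnn_of_notMem hj]
    exact ⟨_, eq_sub_of_add_eq' (isCAR_a.anticomm_star (v j) (v i))⟩

theorem star_vacAnn_mul_mem_sup (hv : Orthonormal ℂ v) (i : ι) {x : CARAlgebra H}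
    (hx : x ∈ wordSpan v I₀ ⊔ vacIdeal v I₀) :
    star (vacAnn v I₀ i) * x ∈ wordSpan v I₀ ⊔ vacIdeal v I₀ := by
  obtain ⟨w, hw, n, hn, rfl⟩ := Submodule.mem_sup.1 hx
  rw [mul_add]
  exact Submodule.add_mem_sup (star_vacAnn_mul_mem hv i hw) (mul_mem_vacIdeal _ hn)

/-- The annihilator is moved to the right through the word. Each exchange leaves a scalar multiple
of a shorter word, and once it has passed all letters the product lies in the left ideal. -/
theorem vacAnn_mul_word_mem_sup (hv : Orthonormal ℂ v) (i : ι) {α β : List ι} (hα : ∀ i ∈ α, i ∉ I₀)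
    (hβ : ∀ i ∈ β, i ∈ I₀) :
    vacAnn v I₀ i * word v α β ∈ wordSpan v I₀ ⊔ vacIdeal v I₀ := by
  have step : ∀ (j : ι) {w : CARAlgebra H}, w ∈ wordSpan v I₀ →
      vacAnn v I₀ i * w ∈ wordSpan v I₀ ⊔ vacIdeal v I₀ →
      vacAnn v I₀ i * (star (vacAnn v I₀ j) * w) ∈ wordSpan v I₀ ⊔ vacIdeal v I₀ := by
    intro j w hw h
    obtain ⟨c, hc⟩ := vacAnn_mul_star_vacAnn (v := v) (I₀ := I₀) i j
    rw [← mul_assoc, hc, sub_mul, smul_mul_assoc, one_mul, mul_assoc]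
    exact sub_mem (Submodule.smul_mem _ c (Submodule.mem_sup_left hw))
      (star_vacAnn_mul_mem_sup hv j h)
  induction α with
  | nil =>
    induction β with
    | nil =>
      have := mul_vacAnn_mem (v := v) (I₀ := I₀) 1 i
      rw [one_mul] at this
      simpa [word] using Submodule.mem_sup_right this
    | cons j β ih =>
      have hβ' : ∀ i ∈ β, i ∈ I₀ := fun k hk => hβ k (List.mem_cons_of_mem _ hk)
      have h := step j (word_mem hα hβ') (ih hβ')
      rwa [vacAnn_of_mem (i := j) (hβ j List.mem_cons_self), star_star, ← word_nil_cons] at h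
  | cons j α ih =>
    have hα' : ∀ i ∈ α, i ∉ I₀ := fun k hk => hα k (List.mem_cons_of_mem _ hk)
    have h := step j (word_mem hα' hβ) (ih hα')
    rwa [vacAnn_of_notMem (i := j) (hα j List.mem_cons_self), ← word_cons_left] at h

theorem vacAnn_mul_mem_sup (hv : Orthonormal ℂ v) (i : ι) {x : CARAlgebra H}
    (hx : x ∈ wordSpan v I₀ ⊔ vacIdeal v I₀) :
    vacAnn v I₀ i * x ∈ wordSpan v I₀ ⊔ vacIdeal v I₀ := by
  obtain ⟨w, hw, n, hn, rfl⟩ := Submodule.mem_sup.1 hx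
  rw [mul_add]
  refine add_mem ?_ (Submodule.mem_sup_right (mul_mem_vacIdeal _ hn))
  induction hw using Submodule.span_induction with
  | mem w hw =>
    obtain ⟨α, β, hα, hβ, rfl⟩ := hw
    exact vacAnn_mul_word_mem_sup hv i hα hβ
  | zero => rw [mul_zero]; exact zero_mem _
  | add y z hy' hz' hy hz =>
    rw [mul_add]
    exact add_mem (hy (Submodule.add_mem_sup hy' hn)) (hz (Submodule.add_mem_sup hz' hn))
  | smul c y hy' hy =>
    rw [mul_smul_comm]; exact Submodule.smul_mem _ c (hy (Submodule.add_mem_sup hy' hn))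

/-- Up to the left ideal of the vacuum, every element is a limit of combinations of words. -/
theorem topologicalClosure_sup_eq_top (hv : Orthonormal ℂ v) (hd : Dense (Submodule.span ℂ (Set.range v) : Set H)) :
    (wordSpan v I₀ ⊔ vacIdeal v I₀).topologicalClosure = ⊤ := by
  have hcl := (wordSpan v I₀ ⊔ vacIdeal v I₀).isClosed_topologicalClosure
  have h1 : ∀ i, ∀ c ∈ (wordSpan v I₀ ⊔ vacIdeal v I₀).topologicalClosure,
      vacAnn v I₀ i * c ∈ (wordSpan v I₀ ⊔ vacIdeal v I₀).topologicalClosure := fun i c hc =>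
    map_mem_closure (f := fun x => vacAnn v I₀ i * x) (by fun_prop) hc
      fun x hx => vacAnn_mul_mem_sup hv i hx
  have h2 : ∀ i, ∀ c ∈ (wordSpan v I₀ ⊔ vacIdeal v I₀).topologicalClosure,
      star (vacAnn v I₀ i) * c ∈ (wordSpan v I₀ ⊔ vacIdeal v I₀).topologicalClosure :=
    fun i c hc => map_mem_closure (f := fun x => star (vacAnn v I₀ i) * x) (by fun_prop) hc
      fun x hx => star_vacAnn_mul_mem_sup hv i hx
  -- The annihilators and creators of the vacuum together are all the `a(v i)` and `a*(v i)`, with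
  -- the roles exchanged for `i ∈ I₀`.
  have h3 : ∀ h, ∀ c ∈ (wordSpan v I₀ ⊔ vacIdeal v I₀).topologicalClosure, _ := fun h c hc =>
    mul_mem_of_dense_span hd hcl (c := c) (fun i => by
      by_cases hi : i ∈ I₀
      · simpa [vacAnn_of_mem hi] using h2 i c hc
      · simpa [vacAnn_of_notMem hi] using h1 i c hc) (fun i => by
      by_cases hi : i ∈ I₀
      · simpa [vacAnn_of_mem hi] using h1 i c hc
      · simpa [vacAnn_of_notMem hi] using h2 i c hc) h
  refine eq_top_of_mul_mem hcl (Submodule.le_topologicalClosure _ (Submodule.mem_sup_left ?_))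
    (fun h c hc => (h3 h c hc).1) fun h c hc => (h3 h c hc).2
  have := word_mem (v := v) (I₀ := I₀) (α := []) (β := []) (by simp) (by simp)
  simpa [word] using this

end Words

end CARAlgebra

/-! ### The vacuum state: null ideal, invariance and charge -/

namespace CARAlgebra
variable {H : Type u} [NormedAddCommGroup H] [InnerProductSpace ℂ H]
variable {ι : Type*} {v : ι → H} {I₀ : Set ι}

theorem norm_toPreGNS_eq_zero {φ : CARAlgebra H →ₚ[ℂ] ℂ} {x : CARAlgebra H}
    (h : φ (star x * x) = 0) : ‖φ.toPreGNS x‖ = 0 := by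
  rw [PositiveLinearMap.preGNS_norm_def, PositiveLinearMap.ofPreGNS_toPreGNS, h]
  simp

/-- Cauchy–Schwarz for the form `φ(star y * x)`: an element of zero seminorm is orthogonal to
everything. -/
theorem apply_mul_eq_zero {φ : CARAlgebra H →ₚ[ℂ] ℂ} {x : CARAlgebra H}
    (h : φ (star x * x) = 0) (y : CARAlgebra H) : φ (y * x) = 0 := by
  have h1 := norm_inner_le_norm (𝕜 := ℂ) (φ.toPreGNS (star y)) (φ.toPreGNS x)
  rw [norm_toPreGNS_eq_zero h, mul_zero, PositiveLinearMap.preGNS_inner_def,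
    PositiveLinearMap.ofPreGNS_toPreGNS, PositiveLinearMap.ofPreGNS_toPreGNS, star_star] at h1
  exact norm_le_zero_iff.1 h1

theorem norm_toPreGNS_of_mem_vacIdeal {φ : CARAlgebra H →ₚ[ℂ] ℂ}
    (hφ : ∀ i, φ (star (vacAnn v I₀ i) * vacAnn v I₀ i) = 0) {x : CARAlgebra H}
    (hx : x ∈ vacIdeal v I₀) : ‖φ.toPreGNS x‖ = 0 := by
  induction hx using Submodule.span_induction with
  | mem x hx =>
    obtain ⟨y, i, rfl⟩ := hx
    refine norm_toPreGNS_eq_zero ?_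
    rw [← mul_assoc]
    exact apply_mul_eq_zero (hφ i) _
  | zero => rw [map_zero, norm_zero]
  | add x y _ _ hx hy =>
    rw [map_add]
    exact le_antisymm ((norm_add_le _ _).trans (by rw [hx, hy, add_zero])) (norm_nonneg _)
  | smul c x _ hx => rw [map_smul, norm_smul, hx, mul_zero]

theorem apply_star_vacAnn_mul {φ : CARAlgebra H →ₚ[ℂ] ℂ}
    (hφ : ∀ i, φ (star (vacAnn v I₀ i) * vacAnn v I₀ i) = 0) (i : ι) (x : CARAlgebra H) :
    φ (star (vacAnn v I₀ i) * x) = 0 := by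
  have h := apply_mul_eq_zero (hφ i) (star x)
  have h2 : star (vacAnn v I₀ i) * x = star (star x * vacAnn v I₀ i) := by simp
  rw [h2, map_star, h, star_zero]

/-- A nonempty word in the creation operators of the vacuum has vanishing expectation. -/
theorem apply_word_eq_zero {φ : CARAlgebra H →ₚ[ℂ] ℂ}
    (hφ : ∀ i, φ (star (vacAnn v I₀ i) * vacAnn v I₀ i) = 0) {α β : List ι}
    (hα : ∀ i ∈ α, i ∉ I₀) (hβ : ∀ i ∈ β, i ∈ I₀) (hne : ¬(α = [] ∧ β = [])) :
    φ (word v α β) = 0 := by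
  cases α with
  | cons j α =>
    have := apply_star_vacAnn_mul hφ j (word v α β)
    rwa [vacAnn_of_notMem (hα j List.mem_cons_self), ← word_cons_left] at this
  | nil =>
    cases β with
    | nil => exact absurd ⟨rfl, rfl⟩ hne
    | cons j β =>
      have := apply_star_vacAnn_mul hφ j (word v [] β)
      rwa [vacAnn_of_mem (hβ j List.mem_cons_self), star_star, ← word_nil_cons] at this

section Diagonal
variable {U : H ≃ₗᵢ[ℂ] H} {c : ι → ℂ}

theorem bogoliubov_word (hU : ∀ i, U (v i) = c i • v i) (α β : List ι) :
    bogoliubov U (word v α β) =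
      ((α.map c).prod * (β.map fun i => star (c i)).prod) • word v α β := by
  have h1 : bogoliubov U (α.map fun i => star (a (v i))).prod =
      (α.map c).prod • (α.map fun i => star (a (v i))).prod := by
    induction α with
    | nil => simp
    | cons j α ih =>
      simp only [List.map_cons, List.prod_cons, map_mul, ih, map_star, bogoliubov_a, hU,
        map_smulₛₗ, star_smul, smul_mul_smul_comm]
      simp
  have h2 : bogoliubov U (β.map fun i => a (v i)).prod =
      (β.map fun i => star (c i)).prod • (β.map fun i => a (v i)).prod := by
    induction β with
    | nil => simp
    | cons j β ih =>
      simp only [List.map_cons, List.prod_cons, map_mul, ih, bogoliubov_a, hU,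
        map_smulₛₗ, smul_mul_smul_comm]
      rfl
  rw [word, map_mul, h1, h2, smul_mul_smul_comm]

theorem bogoliubov_vacAnn (hU : ∀ i, U (v i) = c i • v i) (i : ι) :
    ∃ r : ℂ, bogoliubov U (vacAnn v I₀ i) = r • vacAnn v I₀ i := by
  by_cases hi : i ∈ I₀
  · rw [vacAnn_of_mem hi, map_star, bogoliubov_a, hU, map_smulₛₗ, star_smul]
    exact ⟨_, rfl⟩
  · rw [vacAnn_of_notMem hi, bogoliubov_a, hU, map_smulₛₗ]
    exact ⟨_, rfl⟩

/-- The vacuum state is invariant under diagonal Bogoliubov transforms. -/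
theorem apply_bogoliubov (hv : Orthonormal ℂ v)
    (hd : Dense (Submodule.span ℂ (Set.range v) : Set H)) {φ : CARAlgebra H →ₚ[ℂ] ℂ}
    (hφ : ∀ i, φ (star (vacAnn v I₀ i) * vacAnn v I₀ i) = 0)
    (hU : ∀ i, U (v i) = c i • v i) (x : CARAlgebra H) : φ (bogoliubov U x) = φ x := by
  let E : Submodule ℂ (CARAlgebra H) :=
    LinearMap.eqLocus (φ.toLinearMap ∘ₗ (bogoliubov U).toLinearMap) φ.toLinearMap
  have hE : ∀ {x}, x ∈ E ↔ φ (bogoliubov U x) = φ x := Iff.rfl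
  have hcl : IsClosed (E : Set (CARAlgebra H)) :=
    isClosed_eq ((map_continuous φ).comp (continuous_bogoliubov U)) (map_continuous φ)
  -- On nonempty words and on the ideal both functionals vanish, since a diagonal transform only
  -- rescales words and annihilators; the empty word is `1`, which is fixed.
  have hle : wordSpan v I₀ ⊔ vacIdeal v I₀ ≤ E := by
    refine sup_le (Submodule.span_le.2 ?_) (Submodule.span_le.2 ?_)
    · rintro _ ⟨α, β, hα, hβ, rfl⟩
      refine hE.2 ?_
      rw [bogoliubov_word hU]
      by_cases hne : α = [] ∧ β = []
      · obtain ⟨rfl, rfl⟩ := hne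
        simp
      · rw [map_smul, apply_word_eq_zero hφ hα hβ hne, smul_zero]
    · rintro _ ⟨x, i, rfl⟩
      refine hE.2 ?_
      obtain ⟨r, hr⟩ := bogoliubov_vacAnn (I₀ := I₀) hU i
      rw [map_mul, hr, mul_smul_comm, map_smul, apply_mul_eq_zero (hφ i),
        apply_mul_eq_zero (hφ i), smul_zero]
  have := Submodule.topologicalClosure_minimal _ hle hcl
  rw [topologicalClosure_sup_eq_top hv hd] at this
  exact this (Submodule.mem_top (x := x))

end Diagonal

theorem exists_circle_pow_mul_ne_one {p q : ℕ} (h : p ≠ q) :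
    ∃ z : Circle, (z : ℂ) ^ p * star (z : ℂ) ^ q ≠ 1 := by
  have hne : ((p : ℂ) - q) ≠ 0 := sub_ne_zero.2 (by exact_mod_cast h)
  -- With angle `π / (p - q)` the expression is `exp(i π) = -1`.
  refine ⟨Circle.exp (Real.pi / ((p : ℝ) - q)), ?_⟩
  have h1 : star ((Circle.exp (Real.pi / ((p : ℝ) - q)) : Circle) : ℂ) =
      Complex.exp (-(Real.pi / ((p : ℂ) - q) * Complex.I)) := by
    rw [Circle.coe_exp]
    change (starRingEnd ℂ) _ = _
    rw [← Complex.exp_conj]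
    simp
  rw [h1, Circle.coe_exp, ← Complex.exp_nat_mul, ← Complex.exp_nat_mul, ← Complex.exp_add]
  have h2 : (p : ℂ) * (((Real.pi / ((p : ℝ) - q) : ℝ) : ℂ) * Complex.I) +
      (q : ℂ) * -(Real.pi / ((p : ℂ) - q) * Complex.I) = Real.pi * Complex.I := by
    push_cast
    field_simp
    ring
  rw [h2, Complex.exp_pi_mul_I]
  norm_num

/-- In the state `φ`, words of nonzero charge are orthogonal to the gauge-invariant elements. -/
theorem apply_mul_word_eq_zero (hv : Orthonormal ℂ v)
    (hd : Dense (Submodule.span ℂ (Set.range v) : Set H)) {φ : CARAlgebra H →ₚ[ℂ] ℂ}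
    (hφ : ∀ i, φ (star (vacAnn v I₀ i) * vacAnn v I₀ i) = 0) {x : CARAlgebra H}
    (hx : x ∈ gicarSubalgebra H) {α β : List ι} (h : α.length ≠ β.length) :
    φ (x * word v α β) = 0 := by
  obtain ⟨z, hz⟩ := exists_circle_pow_mul_ne_one h
  -- A gauge transform fixes `x` and multiplies the word by a phase other than `1`, while `φ` is
  -- invariant; so the value is zero.
  have h1 := apply_bogoliubov hv hd hφ (U := gaugeUnitary H z) (c := fun _ => (z : ℂ))
    (fun i => rfl) (x * word v α β)
  rw [map_mul, hx z, bogoliubov_word (c := fun _ => (z : ℂ)) (fun i => rfl), mul_smul_comm,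
    map_smul] at h1
  simp only [List.map_const', List.prod_replicate, smul_eq_mul] at h1
  by_contra h0
  exact hz (mul_right_cancel₀ h0 (by rw [h1, one_mul]))

/-- The span of the words of charge zero in the creation operators of the vacuum. -/
def neutralSpan (v : ι → H) (I₀ : Set ι) : Submodule ℂ (CARAlgebra H) :=
  Submodule.span ℂ {w | ∃ α β : List ι, (∀ i ∈ α, i ∉ I₀) ∧ (∀ i ∈ β, i ∈ I₀) ∧
    α.length = β.length ∧ w = word v α β}

/-- The span of the words of nonzero charge in the creation operators of the vacuum. -/
def chargedSpan (v : ι → H) (I₀ : Set ι) : Submodule ℂ (CARAlgebra H) :=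
  Submodule.span ℂ {w | ∃ α β : List ι, (∀ i ∈ α, i ∉ I₀) ∧ (∀ i ∈ β, i ∈ I₀) ∧
    α.length ≠ β.length ∧ w = word v α β}

theorem wordSpan_le_sup : wordSpan v I₀ ≤ neutralSpan v I₀ ⊔ chargedSpan v I₀ := by
  refine Submodule.span_le.2 ?_
  rintro _ ⟨α, β, hα, hβ, rfl⟩
  by_cases h : α.length = β.length
  · exact Submodule.mem_sup_left (Submodule.subset_span ⟨α, β, hα, hβ, h, rfl⟩)
  · exact Submodule.mem_sup_right (Submodule.subset_span ⟨α, β, hα, hβ, h, rfl⟩)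

theorem apply_mul_eq_zero_of_mem_chargedSpan (hv : Orthonormal ℂ v)
    (hd : Dense (Submodule.span ℂ (Set.range v) : Set H)) {φ : CARAlgebra H →ₚ[ℂ] ℂ}
    (hφ : ∀ i, φ (star (vacAnn v I₀ i) * vacAnn v I₀ i) = 0) {x w : CARAlgebra H}
    (hx : x ∈ gicarSubalgebra H) (hw : w ∈ chargedSpan v I₀) : φ (x * w) = 0 := by
  induction hw using Submodule.span_induction with
  | mem w hw =>
    obtain ⟨α, β, -, -, h, rfl⟩ := hw
    exact apply_mul_word_eq_zero hv hd hφ hx h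
  | zero => rw [mul_zero, map_zero]
  | add y z _ _ hy hz => rw [mul_add, map_add, hy, hz, add_zero]
  | smul c y _ hy => rw [mul_smul_comm, map_smul, hy, smul_zero]

/-- The seminorm is `√φ(star x * x)`, continuous in the norm of the algebra. Norm approximations
thus become approximations in the GNS seminorm. -/
theorem continuous_toPreGNS (φ : CARAlgebra H →ₚ[ℂ] ℂ) : Continuous φ.toPreGNS := by
  refine continuous_of_continuousAt_zero φ.toPreGNS.toLinearMap.toAddMonoidHom ?_
  have h : Continuous fun x : CARAlgebra H => √(φ (star x * x)).re :=
    (Complex.continuous_re.comp ((map_continuous φ).comp (by fun_prop))).sqrt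
  have h0 := h.tendsto 0
  rw [mul_zero, map_zero, Complex.zero_re, Real.sqrt_zero] at h0
  change Filter.Tendsto (fun x => φ.toPreGNS x) (nhds 0) (nhds (φ.toPreGNS 0))
  rw [map_zero]
  exact tendsto_zero_iff_norm_tendsto_zero.2 h0

/-- Gauge-invariant elements are approximated in the state `φ` by combinations of words of charge
zero. -/
theorem exists_neutral_norm_sub_lt (hv : Orthonormal ℂ v)
    (hd : Dense (Submodule.span ℂ (Set.range v) : Set H)) {φ : CARAlgebra H →ₚ[ℂ] ℂ}
    (hφ : ∀ i, φ (star (vacAnn v I₀ i) * vacAnn v I₀ i) = 0)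
    (hgi : neutralSpan v I₀ ≤ Subalgebra.toSubmodule (gicarSubalgebra H).toSubalgebra)
    {x : CARAlgebra H} (hx : x ∈ gicarSubalgebra H) {ε : ℝ} (hε : 0 < ε) :
    ∃ w ∈ neutralSpan v I₀, ‖φ.toPreGNS (x - w)‖ < ε := by
  have hxc : x ∈ closure ((wordSpan v I₀ ⊔ vacIdeal v I₀ : Submodule ℂ (CARAlgebra H)) :
      Set (CARAlgebra H)) := by
    change x ∈ (wordSpan v I₀ ⊔ vacIdeal v I₀).topologicalClosure
    rw [topologicalClosure_sup_eq_top hv hd]; trivial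
  obtain ⟨_, ⟨y, hy, rfl⟩, hlt⟩ := Metric.mem_closure_iff.1
    (map_mem_closure (continuous_toPreGNS φ) hxc fun y hy => Set.mem_image_of_mem _ hy) ε hε
  obtain ⟨w, hw, n, hn, rfl⟩ := Submodule.mem_sup.1 hy
  obtain ⟨w₀, hw₀, w₁, hw₁, rfl⟩ := Submodule.mem_sup.1 (wordSpan_le_sup hw)
  refine ⟨w₀, hw₀, ?_⟩
  have hmem : star (x - w₀) ∈ gicarSubalgebra H := star_mem (sub_mem hx (hgi hw₀))
  -- The approximant is `w₀ + w₁ + n`. The ideal part `n` has seminorm zero, and the charged part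
  -- `w₁` is orthogonal to the gauge-invariant `x - w₀`, so discarding both does not increase the
  -- error.
  have horth : ⟪φ.toPreGNS (x - w₀), φ.toPreGNS w₁⟫_ℂ = 0 :=
    apply_mul_eq_zero_of_mem_chargedSpan hv hd hφ hmem hw₁
  have hn0 := norm_toPreGNS_of_mem_vacIdeal hφ hn
  have h1 : ‖φ.toPreGNS (x - w₀) - φ.toPreGNS w₁‖ < ε := by
    have h2 : φ.toPreGNS (x - w₀) - φ.toPreGNS w₁ =
        (φ.toPreGNS x - φ.toPreGNS (w₀ + w₁ + n)) + φ.toPreGNS n := by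
      simp only [map_sub, map_add]; abel
    rw [h2]
    refine (norm_add_le _ _).trans_lt ?_
    rwa [hn0, add_zero, ← dist_eq_norm]
  refine lt_of_le_of_lt ?_ h1
  have h3 := norm_sub_sq (𝕜 := ℂ) (φ.toPreGNS (x - w₀)) (φ.toPreGNS w₁)
  rw [horth, map_zero, mul_zero, sub_zero] at h3
  refine (sq_le_sq₀ (norm_nonneg _) (norm_nonneg _)).1 ?_
  rw [h3]
  exact le_add_of_nonneg_right (sq_nonneg _)

end CARAlgebra

/-! ### Commutators of number operators with words -/

namespace CARAlgebra
variable {H : Type u} [NormedAddCommGroup H] [InnerProductSpace ℂ H]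
variable {ι : Type*} {v : ι → H} {I₀ : Set ι}

open Classical in
theorem number_mul_star_a (hv : Orthonormal ℂ v) (i j : ι) :
    star (a (v i)) * a (v i) * star (a (v j)) =
      star (a (v j)) * (star (a (v i)) * a (v i)) +
        (if i = j then (1 : ℂ) else 0) • star (a (v j)) := by
  have h1 : star (a (v i)) * star (a (v j)) = -(star (a (v j)) * star (a (v i))) := by
    rw [← star_mul, ← star_mul, eq_neg_of_add_eq_zero_left (isCAR_a.anticomm (v j) (v i)), star_neg]
  have h2 : a (v i) * star (a (v j)) =
      (if i = j then (1 : ℂ) else 0) • 1 - star (a (v j)) * a (v i) := by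
    split_ifs with h
    · rw [← h, star_a_mul_a_self hv, one_smul, sub_sub_cancel]
    · rw [star_a_mul_a_of_ne hv (Ne.symm h), zero_smul, zero_sub, neg_neg]
  have h3 : (if i = j then (1 : ℂ) else 0) • star (a (v i)) =
      (if i = j then (1 : ℂ) else 0) • star (a (v j)) := by
    split_ifs with h
    · rw [h]
    · rw [zero_smul, zero_smul]
  rw [mul_assoc, h2, mul_sub, mul_smul_comm, mul_one, h3, ← mul_assoc, h1, neg_mul, sub_neg_eq_add,
    mul_assoc, add_comm]

open Classical in
theorem number_mul_a (hv : Orthonormal ℂ v) (i j : ι) :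
    star (a (v i)) * a (v i) * a (v j) =
      a (v j) * (star (a (v i)) * a (v i)) + (-if i = j then (1 : ℂ) else 0) • a (v j) := by
  -- The number operator is self-adjoint, so the adjoint of the relation for `a*(v j)` is the one
  -- for `a(v j)`, with the sign of the eigenvalue reversed.
  have h := congrArg star (number_mul_star_a hv i j)
  have hs : star (if i = j then (1 : ℂ) else 0) = if i = j then (1 : ℂ) else 0 := by
    split_ifs <;> simp
  simp only [star_mul, star_star, star_add, star_smul, hs] at h
  rw [h, neg_smul, add_assoc, add_neg_cancel, add_zero]

-- The scalar is the number of occurrences of `i` in `α` minus that in `β`.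
open Classical in
theorem number_mul_word (hv : Orthonormal ℂ v) (i : ι) (α β : List ι) :
    star (a (v i)) * a (v i) * word v α β =
      word v α β * (star (a (v i)) * a (v i)) +
        ((α.map fun j => if i = j then (1 : ℂ) else 0).sum +
          (β.map fun j => -if i = j then (1 : ℂ) else 0).sum) • word v α β := by
  have h1 := List.mul_prod_of_commutator (𝕜 := ℂ) (f := fun j => star (a (v j))) (l := α)
    fun j _ => number_mul_star_a hv i j
  have h2 := List.mul_prod_of_commutator (𝕜 := ℂ) (f := fun j => a (v j)) (l := β)
    fun j _ => number_mul_a hv i j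
  rw [word, ← mul_assoc, h1, add_mul, mul_assoc, h2, mul_add, mul_smul_comm, smul_mul_assoc,
    add_smul, mul_assoc]
  abel

end CARAlgebra

/-! ### Excitation vectors and the Hamiltonian in the GNS space -/

namespace GICAR
open CARAlgebra
variable {H : Type u} [NormedAddCommGroup H] [InnerProductSpace ℂ H]
variable {ι : Type*} {v : ι → H} {I₀ : Set ι}

theorem incl_monomial (v : ι → H) {n : ℕ} (α β : Fin n → ι) :
    incl (monomial (fun i => v (α i)) fun i => v (β i)) =
      word v (List.ofFn α) (List.ofFn β) := by
  simp only [word, List.map_ofFn]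
  rfl

theorem neutralSpan_le_gicarSubalgebra :
    neutralSpan v I₀ ≤ Subalgebra.toSubmodule (gicarSubalgebra H).toSubalgebra := by
  refine Submodule.span_le.2 ?_
  rintro _ ⟨α, β, -, -, h, rfl⟩ z
  rw [bogoliubov_word (c := fun _ => (z : ℂ)) fun i => rfl]
  simp only [List.map_const', List.prod_replicate]
  rw [h, ← mul_pow, circle_mul_star, one_pow, one_smul]

theorem gns_apply_gnsVector (ψ : GICAR H →ₚ[ℂ] ℂ) (x : GICAR H) :
    ψ.gnsStarAlgHom x (gnsVector ψ) = ((ψ.toPreGNS x : ψ.PreGNS) : ψ.GNS) := by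
  have h : ψ.gnsStarAlgHom x (gnsVector ψ) = ψ.leftMulMapPreGNS x (ψ.toPreGNS 1) :=
    ψ.gnsNonUnitalStarAlgHom_apply_coe
  rw [h, PositiveLinearMap.leftMulMapPreGNS_apply]
  simp

/-- Norms in the GNS space of the restricted state are seminorms of the full state, so estimates
made in the CAR algebra, where words need not be neutral, apply there. -/
theorem norm_gns_apply_gnsVector (φ : CARAlgebra H →ₚ[ℂ] ℂ) (x : GICAR H) :
    ‖(restrictGICAR φ).gnsStarAlgHom x (gnsVector (restrictGICAR φ))‖ =
      ‖φ.toPreGNS (incl x)‖ := by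
  rw [gns_apply_gnsVector, UniformSpace.Completion.norm_coe]
  rfl

theorem dense_gns_apply_gnsVector (ψ : GICAR H →ₚ[ℂ] ℂ) :
    Dense (Set.range fun x => ψ.gnsStarAlgHom x (gnsVector ψ)) := by
  have h : (fun x => ψ.gnsStarAlgHom x (gnsVector ψ)) =
      ((↑) : ψ.PreGNS → ψ.GNS) ∘ ψ.toPreGNS := funext (gns_apply_gnsVector ψ)
  rw [h, ψ.toPreGNS.surjective.range_comp]
  exact UniformSpace.Completion.denseRange_coe

/-- The labels of the excitation vectors: equally many modes outside of `I₀` and in `I₀`. -/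
abbrev Excitation (I₀ : Set ι) : Type _ := Σ n : ℕ, (Fin n → ↥(I₀ᶜ)) × (Fin n → ↥I₀)

/-- The monomial that creates an excitation. -/
def excitationMonomial (v : ι → H) (k : Excitation I₀) : GICAR H :=
  monomial (fun i => v (k.2.1 i)) fun i => v (k.2.2 i)

/-- The excitation vectors. -/
def excitationVector (ψ : GICAR H →ₚ[ℂ] ℂ) (v : ι → H) (k : Excitation I₀) : ψ.GNS :=
  ψ.gnsStarAlgHom (excitationMonomial v k) (gnsVector ψ)

/-- The energy of an excitation. -/
def excitationEnergy (m : ι → ℝ) (k : Excitation I₀) : ℝ :=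
  ∑ i, m (k.2.1 i) - ∑ i, m (k.2.2 i)

theorem incl_excitationMonomial (v : ι → H) (k : Excitation I₀) :
    incl (excitationMonomial v k) =
      word v (List.ofFn fun i => (k.2.1 i : ι)) (List.ofFn fun i => (k.2.2 i : ι)) :=
  incl_monomial v _ _

theorem span_range_excitationVector (ψ : GICAR H →ₚ[ℂ] ℂ) (v : ι → H) (I₀ : Set ι) :
    Submodule.span ℂ (Set.range (excitationVector (I₀ := I₀) ψ v)) = excitationSpan ψ v I₀ := by
  refine congrArg (Submodule.span ℂ) (Set.ext fun ξ => ⟨?_, ?_⟩)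
  · rintro ⟨⟨n, α, β⟩, rfl⟩
    exact ⟨n, fun i => α i, fun i => β i, fun i => (α i).2, fun i => (β i).2, rfl⟩
  · rintro ⟨n, α, β, hα, hβ, rfl⟩
    exact ⟨⟨n, fun i => ⟨α i, hα i⟩, fun i => ⟨β i, hβ i⟩⟩, rfl⟩

theorem exists_incl_eq_of_mem_neutralSpan (ψ : GICAR H →ₚ[ℂ] ℂ) {w : CARAlgebra H}
    (hw : w ∈ neutralSpan v I₀) :
    ∃ y : GICAR H, incl y = w ∧ ψ.gnsStarAlgHom y (gnsVector ψ) ∈ excitationSpan ψ v I₀ := by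
  induction hw using Submodule.span_induction with
  | mem w hw =>
    obtain ⟨α, β, hα, hβ, h, rfl⟩ := hw
    obtain ⟨n, α, rfl⟩ : ∃ n, ∃ f : Fin n → ι, α = List.ofFn f :=
      ⟨_, α.get, (List.ofFn_get α).symm⟩
    obtain ⟨m, β, rfl⟩ : ∃ n, ∃ f : Fin n → ι, β = List.ofFn f :=
      ⟨_, β.get, (List.ofFn_get β).symm⟩
    rw [List.length_ofFn, List.length_ofFn] at h
    subst h
    rw [List.forall_mem_ofFn_iff] at hα hβ
    exact ⟨_, incl_monomial v α β, Submodule.subset_span ⟨n, α, β, hα, hβ, rfl⟩⟩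
  | zero => exact ⟨0, map_zero _, by rw [map_zero]; exact zero_mem _⟩
  | add y z _ _ hy hz =>
    obtain ⟨y', rfl, hy'⟩ := hy
    obtain ⟨z', rfl, hz'⟩ := hz
    exact ⟨y' + z', map_add _ _ _, by rw [map_add]; exact add_mem hy' hz'⟩
  | smul c y _ hy =>
    obtain ⟨y', rfl, hy'⟩ := hy
    exact ⟨c • y', map_smul _ _ _, by rw [map_smul]; exact Submodule.smul_mem _ c hy'⟩

section State
variable {φ : CARAlgebra H →ₚ[ℂ] ℂ}

/-- The cyclic vectors `ρ(x) Ω` are dense, and each is approximated by neutral words, whose vectors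
lie in the span. -/
theorem dense_span_excitationVector (hv : Orthonormal ℂ v)
    (hd : Dense (Submodule.span ℂ (Set.range v) : Set H))
    (hφ : ∀ i, φ (star (vacAnn v I₀ i) * vacAnn v I₀ i) = 0) :
    Dense (Submodule.span ℂ (Set.range (excitationVector (I₀ := I₀) (restrictGICAR φ) v)) :
      Set (restrictGICAR φ).GNS) := by
  rw [span_range_excitationVector]
  refine dense_closure.1 ((dense_gns_apply_gnsVector _).mono ?_)
  rintro _ ⟨x, rfl⟩
  refine Metric.mem_closure_iff.2 fun ε hε => ?_
  obtain ⟨w, hw, hlt⟩ := exists_neutral_norm_sub_lt hv hd hφ neutralSpan_le_gicarSubalgebra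
    (x := incl x) x.2 hε
  obtain ⟨y, rfl, hy⟩ := exists_incl_eq_of_mem_neutralSpan (restrictGICAR φ) hw
  refine ⟨_, hy, ?_⟩
  have h : (restrictGICAR φ).gnsStarAlgHom x (gnsVector (restrictGICAR φ)) -
      (restrictGICAR φ).gnsStarAlgHom y (gnsVector (restrictGICAR φ)) =
      (restrictGICAR φ).gnsStarAlgHom (x - y) (gnsVector (restrictGICAR φ)) := by
    rw [map_sub]; rfl
  rw [dist_eq_norm, h, norm_gns_apply_gnsVector, map_sub]
  exact hlt

/-- Elements of the vacuum ideal have seminorm zero, so an eigenvalue equation need only hold modulo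
that ideal. -/
theorem gns_apply_eq_smul_of_sub_mem (hφ : ∀ i, φ (star (vacAnn v I₀ i) * vacAnn v I₀ i) = 0)
    {x y : GICAR H} {c : ℂ} (h : incl (x * y) - c • incl y ∈ vacIdeal v I₀) :
    (restrictGICAR φ).gnsStarAlgHom x
      ((restrictGICAR φ).gnsStarAlgHom y (gnsVector (restrictGICAR φ))) =
      c • (restrictGICAR φ).gnsStarAlgHom y (gnsVector (restrictGICAR φ)) := by
  have h1 : (restrictGICAR φ).gnsStarAlgHom x
      ((restrictGICAR φ).gnsStarAlgHom y (gnsVector (restrictGICAR φ))) -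
      c • (restrictGICAR φ).gnsStarAlgHom y (gnsVector (restrictGICAR φ)) =
      (restrictGICAR φ).gnsStarAlgHom (x * y - c • y) (gnsVector (restrictGICAR φ)) := by
    rw [map_sub, map_mul, map_smul]; rfl
  rw [← sub_eq_zero, h1, ← norm_eq_zero, norm_gns_apply_gnsVector, map_sub, map_smul]
  exact norm_toPreGNS_of_mem_vacIdeal hφ h

-- Past the word, the number operator ends in `a(v γ)`, an annihilator of the vacuum as `γ ∉ I₀`.
-- The eigenvalue counts the particles in mode `γ`.
open Classical in
theorem creAnn_excitationVector (hv : Orthonormal ℂ v)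
    (hφ : ∀ i, φ (star (vacAnn v I₀ i) * vacAnn v I₀ i) = 0) (k : Excitation I₀) (γ : ↥(I₀ᶜ)) :
    (restrictGICAR φ).gnsStarAlgHom (creAnn (v γ) (v γ))
      (excitationVector (restrictGICAR φ) v k) =
      (∑ i, if γ = k.2.1 i then (1 : ℂ) else 0) • excitationVector (restrictGICAR φ) v k := by
  refine gns_apply_eq_smul_of_sub_mem hφ ?_
  have h0 : incl (creAnn (v γ) (v γ)) = star (a (v γ)) * a (v γ) := rfl
  rw [map_mul, h0, incl_excitationMonomial, number_mul_word hv]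
  have h1 : ∀ i, ((γ : ι) = (k.2.2 i : ι)) = False := fun i =>
    eq_false fun h => γ.2 (h ▸ (k.2.2 i).2)
  simp only [List.map_ofFn, List.sum_ofFn, Function.comp_def, h1, if_false, neg_zero,
    Finset.sum_const_zero, add_zero, Subtype.ext_iff, add_sub_cancel_right]
  rw [← mul_assoc, ← vacAnn_of_notMem (v := v) γ.2]
  exact mul_vacAnn_mem _ _

open Classical in
theorem annCre_excitationVector (hv : Orthonormal ℂ v)
    (hφ : ∀ i, φ (star (vacAnn v I₀ i) * vacAnn v I₀ i) = 0) (k : Excitation I₀) (γ : ↥I₀) :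
    (restrictGICAR φ).gnsStarAlgHom (annCre (v γ) (v γ))
      (excitationVector (restrictGICAR φ) v k) =
      (∑ i, if γ = k.2.2 i then (1 : ℂ) else 0) • excitationVector (restrictGICAR φ) v k := by
  refine gns_apply_eq_smul_of_sub_mem hφ ?_
  -- Since `a a* = 1 - a* a`, holes are counted with a positive sign. The number operator remaining
  -- on the right is again written as `1 - a a*`: the two constants cancel and only a term ending in
  -- the annihilator `a*(v γ)` is left.
  have h0 : incl (annCre (v γ) (v γ)) = 1 - star (a (v γ)) * a (v γ) := by
    rw [star_a_mul_a_self hv, sub_sub_cancel]; rfl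
  rw [map_mul, h0, incl_excitationMonomial, sub_mul, one_mul, number_mul_word hv]
  have h1 : ∀ i, ((γ : ι) = (k.2.1 i : ι)) = False := fun i =>
    eq_false fun h => (k.2.1 i).2 (h ▸ γ.2)
  simp only [List.map_ofFn, List.sum_ofFn, Function.comp_def, h1, if_false,
    Finset.sum_const_zero, zero_add, Subtype.ext_iff, Finset.sum_neg_distrib, neg_smul]
  rw [star_a_mul_a_self hv, mul_sub, mul_one, ← mul_assoc, ← vacAnn_of_mem (v := v) γ.2]
  have h2 : ∀ x y z : CARAlgebra H, x - (x - y + -z) - z = y := fun x y z => by abel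
  rw [h2]
  exact mul_vacAnn_mem _ _

/-- The excitation vectors are eigenvectors of the Hamiltonian. -/
theorem excitationVector_mem_hamiltonianGraph (hv : Orthonormal ℂ v) (m : ι → ℝ)
    (hφ : ∀ i, φ (star (vacAnn v I₀ i) * vacAnn v I₀ i) = 0) (k : Excitation I₀) :
    (excitationVector (restrictGICAR φ) v k,
      (excitationEnergy m k : ℂ) • excitationVector (restrictGICAR φ) v k) ∈
      hamiltonianGraph (restrictGICAR φ) v m I₀ := by
  classical
  refine ⟨?_, (∑ i, (m (k.2.1 i) : ℂ) • excitationVector (restrictGICAR φ) v k),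
    (∑ i, (m (k.2.2 i) : ℂ) • excitationVector (restrictGICAR φ) v k), ?_, ?_, ?_⟩
  · rw [← span_range_excitationVector]
    exact Submodule.subset_span ⟨k, rfl⟩
  -- The series is a finite sum, over the particles `i`, of series with a single term at `γ = k.2.1
  -- i`. A label that occurs repeatedly is counted each time.
  · refine (hasSum_sum fun i _ => hasSum_ite_eq (k.2.1 i)
      ((m (k.2.1 i) : ℂ) • excitationVector (restrictGICAR φ) v k)).congr_fun fun γ => ?_
    rw [creAnn_excitationVector hv hφ, Finset.sum_smul, Finset.smul_sum]
    refine Finset.sum_congr rfl fun i _ => ?_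
    split_ifs with h
    · rw [one_smul, h]
    · rw [zero_smul, smul_zero]
  · refine (hasSum_sum fun i _ => hasSum_ite_eq (k.2.2 i)
      ((m (k.2.2 i) : ℂ) • excitationVector (restrictGICAR φ) v k)).congr_fun fun γ => ?_
    rw [annCre_excitationVector hv hφ, Finset.sum_smul, Finset.smul_sum]
    refine Finset.sum_congr rfl fun i _ => ?_
    split_ifs with h
    · rw [one_smul, h]
    · rw [zero_smul, smul_zero]
  · simp only [excitationEnergy, ← Finset.sum_smul, ← sub_smul]
    push_cast
    rfl

/-- The eigenvectors span the whole domain allowed in `hamiltonianGraph`, and the operator is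
single-valued; so nothing beyond the eigenvector graph can occur, and both series converge on the
full span. -/
theorem graph_hamiltonian_eq (hv : Orthonormal ℂ v) (m : ι → ℝ)
    (hφ : ∀ i, φ (star (vacAnn v I₀ i) * vacAnn v I₀ i) = 0) :
    (hamiltonian (restrictGICAR φ) v m I₀).graph =
      eigenGraph (excitationVector (I₀ := I₀) (restrictGICAR φ) v) (excitationEnergy m) := by
  have hle : eigenGraph (excitationVector (I₀ := I₀) (restrictGICAR φ) v) (excitationEnergy m) ≤
      (hamiltonian (restrictGICAR φ) v m I₀).graph := by
    rw [hamiltonian_graph]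
    refine Submodule.span_le.2 ?_
    rintro _ ⟨k, rfl⟩
    exact excitationVector_mem_hamiltonianGraph hv m hφ k
  refine le_antisymm (fun p hp => ?_) hle
  have hfst : excitationSpan (restrictGICAR φ) v I₀ ≤
      (eigenGraph (excitationVector (I₀ := I₀) (restrictGICAR φ) v) (excitationEnergy m)).map
        (LinearMap.fst ℂ _ _) := by
    rw [← span_range_excitationVector]
    refine Submodule.span_le.2 ?_
    rintro _ ⟨k, rfl⟩
    exact ⟨_, Submodule.subset_span ⟨k, rfl⟩, rfl⟩
  have hp' := hp
  rw [hamiltonian_graph] at hp'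
  obtain ⟨q, hq, hqp⟩ := hfst hp'.1
  have h2 := (hamiltonian (restrictGICAR φ) v m I₀).mem_graph_snd_inj' hp (hle hq) hqp.symm
  have h3 : p = q := Prod.ext hqp.symm h2
  rwa [h3]

theorem domain_hamiltonian_eq (hv : Orthonormal ℂ v) (m : ι → ℝ)
    (hφ : ∀ i, φ (star (vacAnn v I₀ i) * vacAnn v I₀ i) = 0) :
    (hamiltonian (restrictGICAR φ) v m I₀).domain = excitationSpan (restrictGICAR φ) v I₀ := by
  rw [← LinearPMap.graph_map_fst_eq_domain, graph_hamiltonian_eq hv m hφ, eigenGraph,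
    Submodule.map_span, ← Set.range_comp, ← span_range_excitationVector]
  rfl

theorem star_exp_I_mul (t r : ℝ) :
    star (Complex.exp (Complex.I * t * r)) = Complex.exp (-(Complex.I * t * r)) := by
  change (starRingEnd ℂ) _ = _
  rw [← Complex.exp_conj]
  simp

theorem bogoliubov_excitationMonomial {m : ι → ℝ} {t : ℝ} {U : H ≃ₗᵢ[ℂ] H}
    (hU : ∀ i, U (v i) = Complex.exp (Complex.I * t * m i) • v i) (k : Excitation I₀) :
    bogoliubov U (excitationMonomial v k) =
      Complex.exp (Complex.I * t * excitationEnergy m k) • excitationMonomial v k := by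
  refine Subtype.ext ?_
  change CARAlgebra.bogoliubov U (incl (excitationMonomial v k)) =
    Complex.exp (Complex.I * t * excitationEnergy m k) • incl (excitationMonomial v k)
  rw [incl_excitationMonomial, bogoliubov_word hU]
  congr 1
  simp only [List.map_ofFn, List.prod_ofFn, Function.comp_def, star_exp_I_mul, ← Complex.exp_sum,
    ← Complex.exp_add, excitationEnergy, Finset.sum_neg_distrib, ← Finset.mul_sum]
  push_cast
  congr 1
  ring

/-- Diagonal Bogoliubov transforms are implemented by isometries of the GNS space. -/
theorem exists_gns_isometry (hv : Orthonormal ℂ v)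
    (hd : Dense (Submodule.span ℂ (Set.range v) : Set H))
    (hφ : ∀ i, φ (star (vacAnn v I₀ i) * vacAnn v I₀ i) = 0) {U : H ≃ₗᵢ[ℂ] H} {c : ι → ℂ}
    (hU : ∀ i, U (v i) = c i • v i) :
    ∃ T : (restrictGICAR φ).GNS →ₗᵢ[ℂ] (restrictGICAR φ).GNS, ∀ x : GICAR H,
      T ((restrictGICAR φ).gnsStarAlgHom x (gnsVector (restrictGICAR φ))) =
        (restrictGICAR φ).gnsStarAlgHom (bogoliubov U x) (gnsVector (restrictGICAR φ)) := by
  set ψ := restrictGICAR φ with hψ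
  let L : ψ.PreGNS →ₗ[ℂ] ψ.PreGNS :=
    ψ.toPreGNS.toLinearMap ∘ₗ (bogoliubov U).toLinearMap ∘ₗ ψ.ofPreGNS.toLinearMap
  -- Invariance of the state makes `L` isometric for the GNS seminorm, so it extends to the
  -- completion.
  have hinv : ∀ x : GICAR H, ψ (bogoliubov U x) = ψ x := fun x =>
    apply_bogoliubov hv hd hφ hU (incl x)
  have hL : ∀ x, ‖L x‖ = ‖x‖ := fun x => by
    rw [PositiveLinearMap.preGNS_norm_def, PositiveLinearMap.preGNS_norm_def]
    change √(ψ (star (bogoliubov U (ψ.ofPreGNS x)) * bogoliubov U (ψ.ofPreGNS x))).re = _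
    rw [← map_star, ← map_mul, hinv]
  let L' : ψ.PreGNS →L[ℂ] ψ.PreGNS := L.mkContinuous 1 fun x => by rw [hL, one_mul]
  have hcoe : ∀ x : ψ.PreGNS, L'.completion (x : ψ.GNS) = ((L x : ψ.PreGNS) : ψ.GNS) := fun x => by
    rw [ContinuousLinearMap.completion_apply_coe]; rfl
  refine ⟨⟨L'.completion.toLinearMap, fun x => ?_⟩, fun x => ?_⟩
  · induction x using UniformSpace.Completion.induction_on with
    | hp => exact isClosed_eq (L'.completion.continuous.norm) continuous_norm
    | ih x =>
      change ‖L'.completion (x : ψ.GNS)‖ = _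
      rw [hcoe, UniformSpace.Completion.norm_coe, UniformSpace.Completion.norm_coe, hL]
  · change L'.completion _ = _
    rw [gns_apply_gnsVector, gns_apply_gnsVector, hcoe]
    rfl

/-- The range of the isometry is closed and contains every excitation vector, which is rescaled by a
nonzero phase; totality makes it everything. -/
theorem exists_gns_unitary (hv : Orthonormal ℂ v)
    (hd : Dense (Submodule.span ℂ (Set.range v) : Set H))
    (hφ : ∀ i, φ (star (vacAnn v I₀ i) * vacAnn v I₀ i) = 0) {m : ι → ℝ} {t : ℝ}
    {U : H ≃ₗᵢ[ℂ] H} (hU : ∀ i, U (v i) = Complex.exp (Complex.I * t * m i) • v i) :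
    ∃ F : (restrictGICAR φ).GNS ≃ₗᵢ[ℂ] (restrictGICAR φ).GNS, ∀ x : GICAR H,
      F ((restrictGICAR φ).gnsStarAlgHom x (gnsVector (restrictGICAR φ))) =
        (restrictGICAR φ).gnsStarAlgHom (bogoliubov U x) (gnsVector (restrictGICAR φ)) := by
  obtain ⟨T, hT⟩ := exists_gns_isometry hv hd hφ hU
  have hcl : IsClosed (LinearMap.range T.toLinearMap : Set (restrictGICAR φ).GNS) :=
    T.isometry.isClosedEmbedding.isClosed_range
  have hle : Submodule.span ℂ
      (Set.range (excitationVector (I₀ := I₀) (restrictGICAR φ) v)) ≤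
      LinearMap.range T.toLinearMap := by
    refine Submodule.span_le.2 ?_
    rintro _ ⟨k, rfl⟩
    refine ⟨(Complex.exp (Complex.I * t * excitationEnergy m k))⁻¹ •
      excitationVector (restrictGICAR φ) v k, ?_⟩
    rw [map_smul]
    change _ • T (excitationVector (restrictGICAR φ) v k) = _
    rw [excitationVector, hT, bogoliubov_excitationMonomial hU, map_smul]
    exact inv_smul_smul₀ (Complex.exp_ne_zero _) _
  have hsurj : Function.Surjective T := fun y =>
    closure_minimal hle hcl (dense_span_excitationVector hv hd hφ y)
  exact ⟨LinearIsometryEquiv.ofSurjective T hsurj, hT⟩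

theorem apply_excitationVector_of_isSecondQuantization {m : ι → ℝ} {U : UnitaryGroup H}
    (hU : ∀ (t : ℝ) i, U.toFun t (v i) = Complex.exp (Complex.I * t * m i) • v i)
    {ψ : GICAR H →ₚ[ℂ] ℂ} {V : UnitaryGroup ψ.GNS} (hV : IsSecondQuantization ψ U V) (t : ℝ)
    (k : Excitation I₀) : V.toFun t (excitationVector ψ v k) =
      Complex.exp (Complex.I * t * excitationEnergy m k) • excitationVector ψ v k := by
  rw [excitationVector, hV, bogoliubov_excitationMonomial (hU t), map_smul]
  rfl

/-- The implementers are diagonal with phases `exp(i t E)` on the total family of excitation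
vectors. This yields the group law, strong continuity and uniqueness at once. -/
theorem existsUnique_isSecondQuantization (hv : Orthonormal ℂ v)
    (hd : Dense (Submodule.span ℂ (Set.range v) : Set H))
    (hφ : ∀ i, φ (star (vacAnn v I₀ i) * vacAnn v I₀ i) = 0) {m : ι → ℝ} {U : UnitaryGroup H}
    (hU : ∀ (t : ℝ) i, U.toFun t (v i) = Complex.exp (Complex.I * t * m i) • v i) :
    ∃! V : UnitaryGroup (restrictGICAR φ).GNS, IsSecondQuantization (restrictGICAR φ) U V := by
  choose F hF using fun t => exists_gns_unitary hv hd hφ (hU t)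
  have he := dense_span_excitationVector hv hd hφ
  obtain ⟨V, hV⟩ := UnitaryGroup.exists_toFun_eq (F := F) (μ := excitationEnergy m) he
    fun t k => by
      rw [excitationVector, hF, bogoliubov_excitationMonomial (hU t), map_smul]
      rfl
  have hVsq : IsSecondQuantization (restrictGICAR φ) U V := fun t x => by rw [hV]; exact hF t x
  refine ⟨V, hVsq, fun W hW => UnitaryGroup.ext (funext fun t =>
    LinearIsometryEquiv.ext_of_dense_span he fun k => ?_)⟩
  rw [apply_excitationVector_of_isSecondQuantization hU hW,
    apply_excitationVector_of_isSecondQuantization hU hVsq]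

end State

/-- The projection fixes `v i` for `i ∈ I₀` and kills it otherwise, so the two-point function is `1`
on occupied modes and `0` on empty ones. -/
theorem quasiFreeState_vacAnn [CompleteSpace H] (hv : Orthonormal ℂ v) (I₀ : Set ι)
    {φ : CARAlgebra H →ₚ[ℂ] ℂ} (hφ : IsQuasiFreeState (spanProjection v I₀) φ) (i : ι) :
    φ (star (vacAnn v I₀ i) * vacAnn v I₀ i) = 0 := by
  by_cases hi : i ∈ I₀
  · have h1 : spanProjection v I₀ (v i) = v i :=
      Submodule.starProjection_eq_self_iff.2
        (Submodule.le_topologicalClosure _ (Submodule.subset_span ⟨i, hi, rfl⟩))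
    have h2 : a (v i) * star (a (v i)) = 1 - star (a (v i)) * a (v i) := by
      rw [star_a_mul_a_self hv, sub_sub_cancel]
    rw [vacAnn_of_mem hi, star_star, h2, map_sub, hφ.map_one, hφ.two_point, h1,
      inner_self_eq_norm_sq_to_K, hv.1 i]
    simp
  · have h1 : spanProjection v I₀ (v i) = 0 := by
      refine (Submodule.starProjection_apply_eq_zero_iff _).2 ?_
      rw [Submodule.orthogonal_closure]
      refine (Submodule.mem_orthogonal _ _).2 fun y hy => ?_
      induction hy using Submodule.span_induction with
      | mem y hy =>
        obtain ⟨j, hj, rfl⟩ := hy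
        exact hv.2 fun h => hi (h ▸ hj)
      | zero => exact inner_zero_left _
      | add y z _ _ hy hz => rw [inner_add_left, hy, hz, add_zero]
      | smul c y _ hy => rw [inner_smul_left, hy, mul_zero]
    rw [vacAnn_of_notMem hi, hφ.two_point, h1, inner_zero_right]

end GICAR

end

theorem theorem4p4 {H : Type*} [NormedAddCommGroup H] [InnerProductSpace ℂ H] [CompleteSpace H]
    {ι : Type*} [Countable ι] (A : H →ₗ.[ℂ] H) (hA : IsSelfAdjoint A)
    (v : HilbertBasis ι ℂ H) (m : ι → ℝ)
    (hv : ∀ α, ∃ hα : v α ∈ A.domain, A ⟨v α, hα⟩ = (m α : ℂ) • v α) (I₀ : Set ι) :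
    (∃! U : UnitaryGroup H, U.generator = A) ∧
    ∀ U : UnitaryGroup H, U.generator = A →
      (∃! V : UnitaryGroup (projectionState v I₀).GNS,
        IsSecondQuantization (projectionState v I₀) U V) ∧
      ∀ V : UnitaryGroup (projectionState v I₀).GNS,
        IsSecondQuantization (projectionState v I₀) U V →
        (hamiltonian (projectionState v I₀) v m I₀).domain =
          excitationSpan (projectionState v I₀) v I₀ ∧
        (hamiltonian (projectionState v I₀) v m I₀).IsClosable ∧
        (hamiltonian (projectionState v I₀) v m I₀).closure = V.generator := by
  have hφ := GICAR.quasiFreeState_vacAnn v.orthonormal I₀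
    (isQuasiFreeState_quasiFreeState _ (spanProjection_nonneg v I₀) (spanProjection_le_one v I₀))
  refine ⟨existsUnique_generator_eq hA hv, fun U hU => ?_⟩
  have hUv := UnitaryGroup.apply_basis_of_generator_eq hv hU
  refine ⟨GICAR.existsUnique_isSecondQuantization v.orthonormal v.dense_span_range hφ hUv,
    fun V hV => ?_⟩
  -- Both sides are the closure of the eigenvector graph. As the right side is the graph of an
  -- operator, this is closability and the identification of the closure in one.
  have hgraph : (hamiltonian (projectionState v I₀) v m I₀).graph.topologicalClosure =
      V.generator.graph := by
    rw [V.graph_generator_eq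
      (GICAR.dense_span_excitationVector v.orthonormal v.dense_span_range hφ)
      (GICAR.apply_excitationVector_of_isSecondQuantization hUv hV)]
    exact congrArg _ (GICAR.graph_hamiltonian_eq v.orthonormal m hφ)
  have hclos : (hamiltonian (projectionState v I₀) v m I₀).IsClosable := ⟨_, hgraph⟩
  refine ⟨GICAR.domain_hamiltonian_eq v.orthonormal m hφ, hclos, LinearPMap.eq_of_eq_graph ?_⟩
  rw [← hclos.graph_closure_eq_closure_graph, hgraph]
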